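/- Let $\Phi\colon L(\mathcal H_A)\to L(\mathcal H_B)$ be a quantum channel from $n_A$ to $n_B$ qubits, let $E$ be a register of $n_A+n_B$ qubits, and let $V_1,\dots,V_T$ be unitary gates on the registers $A,B,E$, each acting nontrivially on at most two qubits, such that $U_\Phi=V_T\cdots V_1$ implements the Stinespring representation of $\Phi$: $$\Phi(\rho)=\mathrm{Tr}_{AE}\bigl(U_\Phi(\rho_A\otimes|0^{n_B}\rangle\langle 0^{n_B}|_B\otimes|0^{n_A+n_B}\rangle\langle 0^{n_A+n_B}|_E)U_\Phi^\dagger\bigr).$$ Let $L\ge 0$, set $V_t=I$ for $t>T$, let $N=T+L$, and let $C=C_1\cdots C_N$ be a clock register of $N$ qubits in which time $t\in\{0,\dots,N\}$ is encoded as $|1^t0^{N-t}\rangle$. Assume that $n_A+n_B+T+L>0$. Consider the Hamiltonian $H_\Phi=H_{\rm in}+H_{\rm prop}+H_{\rm clock}$ on $A,B,E,C$, where $$H_{\rm in}=\sum_{q\in B\cup E}|1\rangle\langle 1|_q\otimes|0\rangle\langle 0|_C,\qquad H_{\rm clock}=I_{ABE}\otimes\sum_{i=1}^{N-1}|01\rangle\langle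 01|_{C_iC_{i+1}},$$ $$H_{\rm prop}=\sum_{t=0}^{N-1}\bigl(-V_{t+1}\otimes|t+1\rangle\langle t|_C-V_{t+1}^\dagger\otimes|t\rangle\langle t+1|_C+I\otimes|t\rangle\langle t|_C+I\otimes|t+1\rangle\langle t+1|_C\bigr),$$ and where, with the conventions $C_0=1$, $C_{N+1}=0$, the symbol $|t\rangle\langle t|_C$ stands for the operator $|10\rangle\langle 10|_{C_tC_{t+1}}$, the symbol $|t+1\rangle\langle t|_C$ for $|110\rangle\langle 100|_{C_tC_{t+1}C_{t+2}}$, and $|t\rangle\langle t+1|_C$ for its adjoint. (This is Kitaev's circuit Hamiltonian without output penalty and with $L$ idling steps appended.) Let $\Delta$ be the spectral gap of $H_\Phi$, i.e. the difference between its two smallest distinct eigenvalues, and let $\|X\|_1=\mathrm{Tr}\sqrt{XX^\dagger}$. Then $H_\Phi$ is a $5$-local Hamiltonian, i.e. a sum of Hermitian terms each acting nontrivially on at most $5$ qubits, and: 1. For every state $\sigma$ on $A$ there is a state $\rho$ on $A,B,C,E$, which is pure if $\sigma$ is pure, such that $\mathrm{Tr}(H_\Phi\rho)=0$ and $\|\rho_B-\Phi(\sigma)\|_1\le\frac{2T}{T+L+1}$.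 2. For every real $\beta$ and every state $\rho$ on $A,B,C,E$ with $\mathrm{Tr}(H_\Phi\rho)\le\beta$ there is a state $\sigma$ on $A$, which is pure if $\rho$ is pure, such that $\|\rho_B-\Phi(\sigma)\|_1\le 2\sqrt{\beta/\Delta}+\frac{2T}{T+L+1}$. Moreover $\Delta\ge c\,(T+L+1)^{-3}$, where $c>0$ is a universal constant, independent of $n_A,n_B,T,L,\Phi$ and the gates. -/

import Mathlib

open scoped Matrix ComplexOrder

noncomputable section

namespace QHam

/-! ### Qubit registers, states, tensor products and partial traces -/

/-- Operators on the qubits labelled by `ι`, in the computational basis `ι → Fin 2`. -/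
abbrev Op (ι : Type) : Type := Matrix (ι → Fin 2) (ι → Fin 2) ℂ

/-- Density operators: positive semidefinite of trace one. -/
def IsState {ι : Type} [Fintype ι] [DecidableEq ι] (ρ : Op ι) : Prop :=
  ρ.PosSemidef ∧ ρ.trace = 1

/-- Pure states `|ψ⟩⟨ψ|` with `ψ` a unit vector. -/
def IsPure {ι : Type} [Fintype ι] [DecidableEq ι] (ρ : Op ι) : Prop :=
  ∃ ψ : (ι → Fin 2) → ℂ, star ψ ⬝ᵥ ψ = 1 ∧ ρ = Matrix.vecMulVec ψ (star ψ)

/-- The projector `|0⋯0⟩⟨0⋯0|`. -/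
def zeroState (ι : Type) [Fintype ι] [DecidableEq ι] : Op ι :=
  Matrix.single 0 0 1

/-- The tensor product of an operator on `ι` and an operator on `κ`. -/
def tensor {ι κ : Type} (M : Op ι) (N : Op κ) : Op (ι ⊕ κ) :=
  fun x y => M (x ∘ Sum.inl) (y ∘ Sum.inl) * N (x ∘ Sum.inr) (y ∘ Sum.inr)

/-- Partial trace over the left register. -/
def traceLeft {ι κ : Type} [Fintype ι] [DecidableEq ι] (M : Op (ι ⊕ κ)) : Op κ :=
  fun x y => ∑ a : ι → Fin 2, M (Sum.elim a x) (Sum.elim a y)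

/-- Partial trace over the right register. -/
def traceRight {ι κ : Type} [Fintype κ] [DecidableEq κ] (M : Op (ι ⊕ κ)) : Op ι :=
  fun x y => ∑ c : κ → Fin 2, M (Sum.elim x c) (Sum.elim y c)

/-- The trace norm `‖M‖₁ = Tr √(M M†)`. -/
def traceNorm {ι : Type} [Fintype ι] [DecidableEq ι] (M : Op ι) : ℝ :=
  (cfc Real.sqrt (M * Mᴴ)).trace.re

/-- The energy `Tr(H ρ)`. -/
def energy {ι : Type} [Fintype ι] [DecidableEq ι] (H ρ : Op ι) : ℝ :=
  (H * ρ).trace.re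

/-- Quantum channels: completely positive trace-preserving linear maps. Complete positivity:
`Φ ⊗ id` preserves positive semidefiniteness for every finite ancilla dimension `k`. -/
def IsChannel {ι κ : Type} [Fintype ι] [DecidableEq ι] [Fintype κ] [DecidableEq κ]
    (Φ : Op ι →ₗ[ℂ] Op κ) : Prop :=
  (∀ ρ, (Φ ρ).trace = ρ.trace) ∧
  ∀ (k : ℕ) (M : Matrix ((ι → Fin 2) × Fin k) ((ι → Fin 2) × Fin k) ℂ), M.PosSemidef →
    (Matrix.of fun p q : (κ → Fin 2) × Fin k =>
      Φ (Matrix.of fun a b => M (a, p.2) (b, q.2)) p.1 q.1).PosSemidef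

/-! ### Locality and spectral gap -/

/-- `M` acts nontrivially only on the qubits in `S`: `M = M' ⊗ I`. -/
def ActsOn {ι : Type} [Fintype ι] [DecidableEq ι] (M : Op ι) (S : Finset ι) : Prop :=
  ∃ M' : Op S, ∀ x y : ι → Fin 2,
    M x y = if ∀ i, i ∉ S → x i = y i then M' (fun i => x i) (fun i => y i) else 0

/-- `k`-local Hamiltonians: finite sums of Hermitian terms acting on at most `k` qubits each. -/
def IsLocalHamiltonian {ι : Type} [Fintype ι] [DecidableEq ι] (k : ℕ) (H : Op ι) : Prop :=
  ∃ (m : ℕ) (h : Fin m → Op ι),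
    (∀ j, (h j).IsHermitian ∧ ∃ S : Finset ι, S.card ≤ k ∧ ActsOn (h j) S) ∧ H = ∑ j, h j

/-- The smallest eigenvalue (of a Hermitian operator). -/
def groundEnergy {ι : Type} [Fintype ι] [DecidableEq ι] (H : Op ι) : ℝ :=
  sInf (spectrum ℝ H)

/-- The spectral gap: the distance from the smallest eigenvalue to the next distinct one. -/
def spectralGap {ι : Type} [Fintype ι] [DecidableEq ι] (H : Op ι) : ℝ :=
  sInf {d : ℝ | ∃ μ ∈ spectrum ℝ H, groundEnergy H < μ ∧ d = μ - groundEnergy H}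

/-! ### Circuits on the registers `A`, `B`, `E` -/

/-- The qubits of the registers `A` (`nA` qubits), `B` (`nB`) and `E` (`nA + nB`). -/
abbrev Work (nA nB : ℕ) : Type := Fin nA ⊕ (Fin nB ⊕ Fin (nA + nB))

/-- The partial trace over `A` and `E`. -/
def reduceB {nA nB : ℕ} (M : Op (Work nA nB)) : Op (Fin nB) :=
  traceRight (traceLeft M)

/-- `V` is a unitary gate acting on at most two qubits. -/
def IsGate {ι : Type} [Fintype ι] [DecidableEq ι] (V : Op ι) : Prop :=
  V ∈ Matrix.unitaryGroup (ι → Fin 2) ℂ ∧ ∃ S : Finset ι, S.card ≤ 2 ∧ ActsOn V S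

/-- The unitary `V_T ⋯ V_1` of a circuit; the gate `V_{t+1}` is `V t`. -/
def circuitUnitary {ι : Type} [Fintype ι] [DecidableEq ι] {T : ℕ} (V : Fin T → Op ι) : Op ι :=
  (List.ofFn V).reverse.prod

/-- The circuit implements the Stinespring representation of `Φ`:
`Φ(ρ) = Tr_{AE}(U (ρ ⊗ |0⟩⟨0|_B ⊗ |0⟩⟨0|_E) U†)` with `U = V_T ⋯ V_1`. -/
def ImplementsStinespring {nA nB T : ℕ} (V : Fin T → Op (Work nA nB))
    (Φ : Op (Fin nA) →ₗ[ℂ] Op (Fin nB)) : Prop :=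
  ∀ ρ, Φ ρ = reduceB (circuitUnitary V *
    tensor ρ (tensor (zeroState (Fin nB)) (zeroState (Fin (nA + nB)))) * (circuitUnitary V)ᴴ)

/-- `V_{t+1}`, where `V_{t+1} = I` for the idling steps `t ≥ T`. -/
def gateAt {ι : Type} [Fintype ι] [DecidableEq ι] {T : ℕ} (V : Fin T → Op ι) (t : ℕ) : Op ι :=
  if h : t < T then V ⟨t, h⟩ else 1

/-! ### The unary clock

The clock consists of `N` qubits `C_1, …, C_N`, and time `t ∈ {0, …, N}` is encoded as
`|1^t 0^(N-t)⟩`. With the conventions `C_0 = 1` and `C_{N+1} = 0`, the operators `|t⟩⟨t|` and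
`|t+1⟩⟨t|` are realized, as usual, by `|10⟩⟨10|` on `C_t C_{t+1}` and by `|110⟩⟨100|` on
`C_t C_{t+1} C_{t+2}`. -/

/-- The value of `C_i` in the clock string `c` (here `C_{i+1}` is `c i`). -/
def clockBit {N : ℕ} (c : Fin N → Fin 2) (i : ℕ) : Fin 2 :=
  if i = 0 then 1 else if h : i - 1 < N then c ⟨i - 1, h⟩ else 0

/-- `|t⟩⟨t|_C`, realized as `|10⟩⟨10|` on `C_t C_{t+1}`. -/
def clockProj (N t : ℕ) : Op (Fin N) :=
  Matrix.diagonal fun c => if clockBit c t = 1 ∧ clockBit c (t + 1) = 0 then 1 else 0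

/-- `|t+1⟩⟨t|_C`, realized as `|110⟩⟨100|` on `C_t C_{t+1} C_{t+2}`, for `t < N`. -/
def clockRaise (N t : ℕ) : Op (Fin N) := fun x y =>
  if clockBit y t = 1 ∧ clockBit y (t + 1) = 0 ∧ clockBit y (t + 2) = 0 ∧
      clockBit x (t + 1) = 1 ∧ ∀ i : Fin N, (i : ℕ) ≠ t → x i = y i
  then 1 else 0

/-- `|01⟩⟨01|` on `C_i C_{i+1}`. -/
def clockPenalty (N i : ℕ) : Op (Fin N) :=
  Matrix.diagonal fun c => if clockBit c i = 0 ∧ clockBit c (i + 1) = 1 then 1 else 0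

/-- The projector `|1⟩⟨1| = I - |0⟩⟨0|` on the qubit `q`. -/
def oneProj {ι : Type} [Fintype ι] [DecidableEq ι] (q : ι) : Op ι :=
  Matrix.diagonal fun x => if x q = 1 then 1 else 0

/-! ### The channel Hamiltonian -/

/-- `H_in`: at time `0`, every qubit of `B` and `E` is penalized unless it is `|0⟩`. -/
def hIn (nA nB N : ℕ) : Op (Work nA nB ⊕ Fin N) :=
  ∑ q : Fin nB ⊕ Fin (nA + nB), tensor (oneProj (Sum.inr q : Work nA nB)) (clockProj N 0)

/-- `H_prop`, summed over the time steps `t = 0, …, T + L - 1`. -/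
def hProp {nA nB T : ℕ} (V : Fin T → Op (Work nA nB)) (L : ℕ) :
    Op (Work nA nB ⊕ Fin (T + L)) :=
  ∑ t ∈ Finset.range (T + L),
    (-tensor (gateAt V t) (clockRaise (T + L) t)
      - tensor (gateAt V t)ᴴ (clockRaise (T + L) t)ᴴ
      + tensor (1 : Op (Work nA nB)) (clockProj (T + L) t)
      + tensor (1 : Op (Work nA nB)) (clockProj (T + L) (t + 1)))

/-- `H_clock`, summed over the pairs `C_i C_{i+1}` with `1 ≤ i < N`. -/
def hClock (nA nB N : ℕ) : Op (Work nA nB ⊕ Fin N) :=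
  ∑ i ∈ Finset.Ico 1 N, tensor (1 : Op (Work nA nB)) (clockPenalty N i)

/-- Kitaev's circuit Hamiltonian without output penalty and with `L` idling steps appended. -/
def channelHamiltonian {nA nB T : ℕ} (V : Fin T → Op (Work nA nB)) (L : ℕ) :
    Op (Work nA nB ⊕ Fin (T + L)) :=
  hIn nA nB (T + L) + hProp V L + hClock nA nB (T + L)

/-- The reduced state on `B` of an operator on the registers `A`, `B`, `E`, `C`. -/
def marginalB {nA nB N : ℕ} (ρ : Op (Work nA nB ⊕ Fin N)) : Op (Fin nB) :=
  reduceB (traceRight ρ)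

end QHam

end

open QHam

open scoped Matrix ComplexOrder
set_option linter.unusedSectionVars false

namespace QHam

open Matrix

/-! ### Tensor products and partial traces -/

section Registers

variable {ι κ : Type} [Fintype ι] [DecidableEq ι] [Fintype κ] [DecidableEq κ]

/-! Write `N = T + L`. Every term of the Hamiltonian is positive semidefinite, and the common kernel
is the space of history states: the range of an isometry `K = history V N` that sends `|a⟩` to the
uniform superposition over `t ≤ N` of `V_t ⋯ V_1 |a,0,0⟩ ⊗ |t⟩`.

Tracing out the clock of `K σ K†` leaves the uniform mixture of the circuit states at times `0, …,
N`. From time `T` on the output on `B` is already `Φ σ`, so only `T` of the `N + 1` outputs can be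
wrong, each by at most `2` in trace norm. This gives part 1, and part 2 for exact ground states
(`trace_mul_history_sub_le`). A state of energy at most `β` has weight at least `1 - β/Δ` on the
ground space, and gentle measurement replaces it by its normalized projection, which has the form `K
σ K†` and costs `2 √(β/Δ)` (`GroundSpace.exists_ground_state`). Trace norms enter only by duality: a
Hermitian `M` has a Hermitian unitary `Q` with `‖M‖₁ = Tr (Q M)`. One `Q` on `B`, lifted to all
registers, tests both approximations, so the two bounds simply add.

For the gap, each time step is `D† D` plus projectors onto illegal clock patterns (`step_eq`).
Undoing the circuit at each time (`rewind`) turns the energy on legal clock strings into independent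
path Laplacians on `{0, …, N}`, one per basis string of the work register, with an extra penalty at
time `0` when `B` or `E` is not all zero. Illegal clock strings cost at least `1` each. A Poincaré
inequality on the path then bounds the energy below by `pathGap N = 1 / (2 (N + 1)²)` times the
squared distance to the history states (`groundSpace_channelHamiltonian`), which is stronger than
the cubic bound required. -/

theorem sum_sum_elim {α : Type*} [AddCommMonoid α] (f : (ι ⊕ κ → Fin 2) → α) :
    ∑ z, f z = ∑ x : ι → Fin 2, ∑ c : κ → Fin 2, f (Sum.elim x c) := by
  rw [← (Equiv.sumArrowEquivProdArrow ι κ (Fin 2)).symm.sum_comp, Fintype.sum_prod_type]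
  rfl

@[simp] theorem tensor_elim {ι κ : Type} (M : Op ι) (N : Op κ) (x x' : ι → Fin 2)
    (c c' : κ → Fin 2) :
    tensor M N (Sum.elim x c) (Sum.elim x' c') = M x x' * N c c' := rfl

theorem tensor_mul_tensor (A C : Op ι) (B D : Op κ) :
    tensor A B * tensor C D = tensor (A * C) (B * D) := by
  ext z w
  simp only [Matrix.mul_apply, tensor, sum_sum_elim, Sum.elim_comp_inl, Sum.elim_comp_inr,
    Finset.sum_mul_sum]
  exact Finset.sum_congr rfl fun _ _ => Finset.sum_congr rfl fun _ _ => by ring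

theorem tensor_conjTranspose {ι κ : Type} (A : Op ι) (B : Op κ) :
    (tensor A B)ᴴ = tensor Aᴴ Bᴴ := by
  ext z w
  simp [tensor, Matrix.conjTranspose_apply]

theorem elim_eq_elim_iff {ι κ α : Type*} {x x' : ι → α} {c c' : κ → α} :
    Sum.elim x c = Sum.elim x' c' ↔ x = x' ∧ c = c' := by
  simp [funext_iff]

theorem tensor_one_one : tensor (1 : Op ι) (1 : Op κ) = 1 := by
  ext z w
  rw [← Sum.elim_comp_inl_inr z, ← Sum.elim_comp_inl_inr w, tensor_elim]
  simp only [Matrix.one_apply, elim_eq_elim_iff]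
  split_ifs <;> simp_all

theorem tensor_add_right {ι κ : Type} (A : Op ι) (B C : Op κ) :
    tensor A (B + C) = tensor A B + tensor A C := by
  ext z w; simp [tensor, mul_add]

/-- Partial trace is dual to padding an observable with the identity. This moves a test operator on
`B` to the full register without a monotonicity theorem for the trace norm. -/
theorem trace_tensor_one_left_mul (Q : Op κ) (M : Op (ι ⊕ κ)) :
    (tensor 1 Q * M).trace = (Q * traceLeft M).trace := by
  simp only [Matrix.trace, Matrix.diag, Matrix.mul_apply, traceLeft, sum_sum_elim, tensor_elim,
    Matrix.one_apply, ite_mul, one_mul, zero_mul, Finset.mul_sum]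
  rw [Finset.sum_comm]
  refine Finset.sum_congr rfl fun c _ => ?_
  rw [Finset.sum_comm]
  conv_rhs => rw [Finset.sum_comm]
  rw [Finset.sum_comm]
  refine Finset.sum_congr rfl fun x _ => ?_
  rw [Finset.sum_comm]
  simp

theorem trace_tensor_one_right_mul (Q : Op ι) (M : Op (ι ⊕ κ)) :
    (tensor Q 1 * M).trace = (Q * traceRight M).trace := by
  simp only [Matrix.trace, Matrix.diag, Matrix.mul_apply, traceRight, sum_sum_elim, tensor_elim,
    Matrix.one_apply, mul_ite, ite_mul, mul_one, mul_zero, zero_mul, Finset.mul_sum]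
  refine Finset.sum_congr rfl fun x _ => ?_
  rw [Finset.sum_comm]
  refine Finset.sum_congr rfl fun y _ => ?_
  simp

theorem IsState.traceLeft {M : Op (ι ⊕ κ)} (h : IsState M) : IsState (traceLeft M) := by
  constructor
  · have : QHam.traceLeft M = ∑ a : ι → Fin 2, M.submatrix (Sum.elim a) (Sum.elim a) := by
      ext x y; simp [QHam.traceLeft, Matrix.sum_apply]
    rw [this]
    exact posSemidef_sum _ fun a _ => h.1.submatrix _
  · have := trace_tensor_one_left_mul (1 : Op κ) M
    rw [tensor_one_one, one_mul, one_mul, h.2] at this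
    exact this.symm

theorem IsState.traceRight {M : Op (ι ⊕ κ)} (h : IsState M) : IsState (traceRight M) := by
  constructor
  · have : QHam.traceRight M =
        ∑ c : κ → Fin 2, M.submatrix (fun x => Sum.elim x c) (fun x => Sum.elim x c) := by
      ext x y; simp [QHam.traceRight, Matrix.sum_apply]
    rw [this]
    exact posSemidef_sum _ fun a _ => h.1.submatrix _
  · have := trace_tensor_one_right_mul (1 : Op ι) M
    rw [tensor_one_one, one_mul, one_mul, h.2] at this
    exact this.symm

theorem IsState.conj {m : Type} [Fintype m] [DecidableEq m] {σ : Op m} (h : IsState σ)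
    {K : Matrix (ι → Fin 2) (m → Fin 2) ℂ} (hK : Kᴴ * K = 1) : IsState (K * σ * Kᴴ) := by
  refine ⟨h.1.mul_mul_conjTranspose_same K, ?_⟩
  rw [Matrix.trace_mul_comm, ← Matrix.mul_assoc, hK, Matrix.one_mul, h.2]

theorem conj_vecMulVec {m n : Type} [Fintype m] (K : Matrix n m ℂ) (ψ : m → ℂ) :
    K * vecMulVec ψ (star ψ) * Kᴴ = vecMulVec (K *ᵥ ψ) (star (K *ᵥ ψ)) := by
  rw [Matrix.mul_vecMulVec, Matrix.vecMulVec_mul, Matrix.star_mulVec]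

theorem IsPure.conj {m : Type} [Fintype m] [DecidableEq m] {σ : Op m} (h : IsPure σ)
    {K : Matrix (ι → Fin 2) (m → Fin 2) ℂ} (hK : Kᴴ * K = 1) : IsPure (K * σ * Kᴴ) := by
  obtain ⟨ψ, hψ, rfl⟩ := h
  refine ⟨K *ᵥ ψ, ?_, conj_vecMulVec K ψ⟩
  rw [Matrix.star_mulVec, ← Matrix.dotProduct_mulVec, Matrix.mulVec_mulVec, hK, Matrix.one_mulVec,
    hψ]

/-- Supplies a witness in the degenerate case where a state has no weight on the ground space. -/
theorem exists_isState_isPure (ι : Type) [Fintype ι] [DecidableEq ι] :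
    ∃ σ : Op ι, IsState σ ∧ IsPure σ := by
  have h : star (Pi.single 0 1 : (ι → Fin 2) → ℂ) ⬝ᵥ Pi.single 0 1 = 1 := by simp
  refine ⟨_, ⟨posSemidef_vecMulVec_self_star (Pi.single 0 1), ?_⟩, _, h, rfl⟩
  rw [Matrix.trace_vecMulVec, dotProduct_comm, h]

end Registers

/-! ### The trace norm -/

section TraceNorm

variable {ι : Type} [Fintype ι] [DecidableEq ι]

/-- The trace norm of a Hermitian operator is attained at a Hermitian unitary. -/
theorem exists_traceNorm_eq {M : Op ι} (hM : M.IsHermitian) :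
    ∃ Q : Op ι, Q.IsHermitian ∧ Q * Q = 1 ∧ traceNorm M = (Q * M).trace.re := by
  have hsa : IsSelfAdjoint M := hM
  have hc : ∀ f : ℝ → ℝ, ContinuousOn f (spectrum ℝ M) := fun f =>
    (Matrix.finite_real_spectrum (A := M)).continuousOn f
  -- A sign function with value `1` at `0`, so that `s² = 1` everywhere and `Q` is unitary even when
  -- `M` is singular.
  let s : ℝ → ℝ := fun x => if 0 ≤ x then 1 else -1
  refine ⟨cfc s M, ?_, ?_, ?_⟩
  · exact cfc_predicate s M
  · rw [← cfc_mul s s M (hc _) (hc _), ← cfc_one ℝ M]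
    refine cfc_congr fun x _ => ?_
    simp only [s]; split_ifs <;> simp
  · have h1 : M * Mᴴ = cfc (fun x : ℝ => x * x) M := by
      rw [cfc_mul _ _ M (hc _) (hc _), cfc_id' ℝ M, hM.eq]
    have h2 : cfc s M * M = cfc (fun x : ℝ => s x * x) M := by
      rw [cfc_mul _ _ M (hc _) (hc _), cfc_id' ℝ M]
    rw [traceNorm, h1, h2, ← cfc_comp' Real.sqrt (fun x : ℝ => x * x) M
      Real.continuous_sqrt.continuousOn (hc _)]
    congr 2
    refine cfc_congr fun x _ => ?_
    simp only [s, Real.sqrt_mul_self_eq_abs]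
    split_ifs with h
    · rw [abs_of_nonneg h, one_mul]
    · rw [abs_of_neg (not_le.1 h), neg_one_mul]

open scoped MatrixOrder in
theorem exists_eq_mul_conjTranspose {n : Type*} [Fintype n] [DecidableEq n] {A : Matrix n n ℂ}
    (hA : A.PosSemidef) : ∃ R : Matrix n n ℂ, A = R * Rᴴ := by
  obtain ⟨B, hB⟩ := CStarAlgebra.nonneg_iff_eq_star_mul_self.1 hA.nonneg
  exact ⟨Bᴴ, by rw [hB, conjTranspose_conjTranspose]; rfl⟩

theorem trace_mul_nonneg {n : Type*} [Fintype n] [DecidableEq n] {A B : Matrix n n ℂ}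
    (hA : A.PosSemidef) (hB : B.PosSemidef) : 0 ≤ (A * B).trace.re := by
  obtain ⟨R, rfl⟩ := exists_eq_mul_conjTranspose hB
  rw [← Matrix.mul_assoc, Matrix.trace_mul_comm, ← Matrix.mul_assoc]
  exact (Complex.le_def.1 (hA.conjTranspose_mul_mul_same R).trace_nonneg).1

/-- Since `Q² = 1`, the operator `(1 - Q)/2` is a projector. -/
theorem posSemidef_one_sub {n : Type*} [Fintype n] [DecidableEq n] {Q : Matrix n n ℂ}
    (hQ : Q.IsHermitian) (hQQ : Q * Q = 1) : (1 - Q).PosSemidef := by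
  have h : (1 - Q) = (2⁻¹ : ℝ) • ((1 - Q)ᴴ * (1 - Q)) := by
    rw [conjTranspose_sub, conjTranspose_one, hQ.eq, sub_mul, mul_sub, mul_sub, hQQ, one_mul,
      mul_one, one_mul]
    ext i j
    simp
    ring
  rw [h]
  exact (posSemidef_conjTranspose_mul_self _).smul (by norm_num)

theorem IsState.trace_mul_le_one {τ Q : Op ι} (h : IsState τ) (hQ : Q.IsHermitian)
    (hQQ : Q * Q = 1) : (Q * τ).trace.re ≤ 1 := by
  have := trace_mul_nonneg (posSemidef_one_sub hQ hQQ) h.1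
  rw [sub_mul, one_mul, trace_sub, h.2, Complex.sub_re, Complex.one_re] at this
  linarith

theorem IsState.neg_one_le_trace_mul {τ Q : Op ι} (h : IsState τ) (hQ : Q.IsHermitian)
    (hQQ : Q * Q = 1) : -1 ≤ (Q * τ).trace.re := by
  have := h.trace_mul_le_one (Q := -Q) hQ.neg (by simpa using hQQ)
  rw [neg_mul, trace_neg, Complex.neg_re] at this
  linarith

end TraceNorm

/-! ### Gentle measurement -/

theorem trace_conjTranspose_mul_self_re {m n : Type*} [Fintype m] [Fintype n]
    (X : Matrix m n ℂ) : (Xᴴ * X).trace.re = ∑ i, ∑ j, ‖X i j‖ ^ 2 := by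
  rw [Finset.sum_comm]
  simp [Matrix.trace, Matrix.mul_apply, ← Complex.normSq_eq_norm_sq, Complex.normSq_apply]

/-- Cauchy–Schwarz for the Hilbert–Schmidt inner product. -/
theorem trace_conjTranspose_mul_re_le {m n : Type*} [Fintype m] [Fintype n]
    (X Y : Matrix m n ℂ) :
    (Xᴴ * Y).trace.re ≤ √((Xᴴ * X).trace.re) * √((Yᴴ * Y).trace.re) := by
  have h : (Xᴴ * Y).trace.re ≤ ∑ p : m × n, ‖X p.1 p.2‖ * ‖Y p.1 p.2‖ := by
    rw [Fintype.sum_prod_type, Finset.sum_comm]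
    simp only [Matrix.trace, Matrix.mul_apply, Matrix.diag, Complex.re_sum]
    refine Finset.sum_le_sum fun j _ => Finset.sum_le_sum fun i _ => ?_
    refine (Complex.re_le_norm _).trans ?_
    simp
  rw [trace_conjTranspose_mul_self_re, trace_conjTranspose_mul_self_re, ← Fintype.sum_prod_type',
    ← Fintype.sum_prod_type']
  exact h.trans (Real.sum_mul_le_sqrt_mul_sqrt _ _ _)

/-- The gentle measurement bound: projecting a state with a projector `P` of success
probability `p` changes expectations of Hermitian unitaries by at most `2 √(1 - p)`. -/
theorem gentle_measurement {n : Type*} [Fintype n] [DecidableEq n] {ρ P Q : Matrix n n ℂ}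
    (hρ : ρ.PosSemidef) (htr : ρ.trace = 1) (hP : P.IsHermitian) (hPP : P * P = P)
    (hQ : Q.IsHermitian) (hQQ : Q * Q = 1) {p : ℝ} (hp : (P * ρ).trace = p) (h0 : 0 < p) :
    (Q * (ρ - ((p⁻¹ : ℝ) : ℂ) • (P * ρ * P))).trace.re ≤ 2 * √(1 - p) := by
  obtain ⟨R, rfl⟩ := exists_eq_mul_conjTranspose hρ
  have hR : (Rᴴ * R).trace = 1 := by rw [Matrix.trace_mul_comm, htr]
  have hPR : (Rᴴ * P * R).trace = p := by
    rw [Matrix.trace_mul_cycle, Matrix.trace_mul_comm, hp]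
  let s : ℝ := (√p)⁻¹
  have hs : s * s = p⁻¹ := by
    rw [← mul_inv, Real.mul_self_sqrt h0.le]
  have hsp : s * p = √p := by
    rw [inv_mul_eq_div, Real.div_sqrt]
  -- `R` plays the role of a purification of `ρ = R R†`, and `S` that of the projected, normalized
  -- state. Their overlap is `√p`.
  let S : Matrix n n ℂ := (s : ℂ) • (P * R)
  have hSh : Sᴴ = (s : ℂ) • (Rᴴ * P) := by
    simp [S, conjTranspose_smul, conjTranspose_mul, hP.eq]
  have hRS : (Rᴴ * S).trace = (√p : ℝ) := by
    rw [Matrix.mul_smul, ← Matrix.mul_assoc, trace_smul, hPR, smul_eq_mul, ← Complex.ofReal_mul,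
      hsp]
  have hSR : (Sᴴ * R).trace = (√p : ℝ) := by
    rw [hSh, Matrix.smul_mul, trace_smul, hPR, smul_eq_mul, ← Complex.ofReal_mul, hsp]
  have hSS : (Sᴴ * S).trace = 1 := by
    rw [hSh, Matrix.smul_mul, Matrix.mul_smul, Matrix.mul_assoc, ← Matrix.mul_assoc P P R, hPP,
      ← Matrix.mul_assoc, trace_smul, trace_smul, hPR, smul_smul, smul_eq_mul,
      ← Complex.ofReal_mul, hs, ← Complex.ofReal_mul, inv_mul_cancel₀ h0.ne', Complex.ofReal_one]
  have hSS' : S * Sᴴ = ((p⁻¹ : ℝ) : ℂ) • (P * (R * Rᴴ) * P) := by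
    rw [hSh, Matrix.smul_mul, Matrix.mul_smul, smul_smul, ← Complex.ofReal_mul, hs]
    simp only [Matrix.mul_assoc]
  -- A difference of squares: the cross terms `Tr (R† Q S)` and `Tr (S† Q R)` are complex
  -- conjugates, so they cancel in the real part. Cauchy–Schwarz then leaves `‖R - S‖² ‖R + S‖² = (2
  -- - 2√p)(2 + 2√p) = 4 (1 - p)`.
  have key : (Q * (R * Rᴴ - S * Sᴴ)).trace.re = ((R - S)ᴴ * (Q * (R + S))).trace.re := by
    have h1 : (Q * (R * Rᴴ)).trace = (Rᴴ * (Q * R)).trace := by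
      rw [← Matrix.mul_assoc, Matrix.trace_mul_comm]
    have h2 : (Q * (S * Sᴴ)).trace = (Sᴴ * (Q * S)).trace := by
      rw [← Matrix.mul_assoc, Matrix.trace_mul_comm]
    have h3 : (Sᴴ * (Q * R)).trace = star (Rᴴ * (Q * S)).trace := by
      rw [← Matrix.trace_conjTranspose]
      simp [conjTranspose_mul, hQ.eq, Matrix.mul_assoc]
    rw [conjTranspose_sub, mul_sub, mul_add, sub_mul, mul_add, mul_add, trace_sub, trace_sub,
      trace_add, trace_add, h1, h2, h3]
    simp
    ring
  rw [← hSS', key]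
  refine (trace_conjTranspose_mul_re_le _ _).trans ?_
  have e1 : ((R - S)ᴴ * (R - S)).trace.re = 2 - 2 * √p := by
    rw [conjTranspose_sub, mul_sub, sub_mul, sub_mul, trace_sub, trace_sub, trace_sub, hR, hRS,
      hSR, hSS]
    simp; ring
  have e2 : ((Q * (R + S))ᴴ * (Q * (R + S))).trace.re = 2 + 2 * √p := by
    rw [conjTranspose_mul, hQ.eq, Matrix.mul_assoc, ← Matrix.mul_assoc Q Q, hQQ, one_mul,
      conjTranspose_add, mul_add, add_mul, add_mul, trace_add, trace_add, trace_add, hR, hRS,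
      hSR, hSS]
    simp; ring
  rw [e1, e2, ← Real.sqrt_mul' _ (by positivity)]
  have : (2 - 2 * √p) * (2 + 2 * √p) = 2 ^ 2 * (1 - p) := by
    nlinarith [Real.mul_self_sqrt h0.le]
  rw [this, Real.sqrt_mul (by norm_num), Real.sqrt_sq (by norm_num)]

/-! ### Spectral gap of a Hamiltonian with a known ground space -/

section Gap

variable {ι : Type} [Fintype ι] [DecidableEq ι] {m : Type} [Fintype m] [DecidableEq m]

/-- The columns of the isometry `K` span the kernel of `H ≥ 0`, and `H ≥ γ` on the orthogonal
complement of the kernel. -/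
structure GroundSpace (H : Op ι) (K : Matrix (ι → Fin 2) m ℂ) (γ : ℝ) : Prop where
  posSemidef : H.PosSemidef
  isometry : Kᴴ * K = 1
  mul_eq_zero : H * K = 0
  gap_pos : 0 < γ
  gap_le : ∀ v : (ι → Fin 2) → ℂ,
    γ * ((star v ⬝ᵥ v).re - (star (Kᴴ *ᵥ v) ⬝ᵥ (Kᴴ *ᵥ v)).re) ≤ (star v ⬝ᵥ H *ᵥ v).re

theorem exists_eigenvector {M : Op ι} (hM : M.IsHermitian) {μ : ℝ} (hμ : μ ∈ spectrum ℝ M) :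
    ∃ v : (ι → Fin 2) → ℂ, (star v ⬝ᵥ v) = 1 ∧ M *ᵥ v = (μ : ℂ) • v := by
  rw [hM.spectrum_real_eq_range_eigenvalues] at hμ
  obtain ⟨i, rfl⟩ := hμ
  refine ⟨hM.eigenvectorBasis i, ?_, ?_⟩
  · have := inner_self_eq_norm_sq_to_K (𝕜 := ℂ) (hM.eigenvectorBasis i)
    rw [hM.eigenvectorBasis.norm_eq_one, EuclideanSpace.inner_eq_star_dotProduct,
      dotProduct_comm] at this
    simpa using this
  · have := hM.mulVec_eigenvectorBasis i
    rw [this]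
    ext; simp

namespace GroundSpace

variable {H : Op ι} {K : Matrix (ι → Fin 2) m ℂ} {γ : ℝ}

theorem conjTranspose_mul_eq_zero (h : GroundSpace H K γ) : Kᴴ * H = 0 := by
  rw [← h.posSemidef.1.eq, ← conjTranspose_mul, h.mul_eq_zero, conjTranspose_zero]

/-- As `K† H = 0`, an eigenvector with nonzero eigenvalue is orthogonal to the range of `K`, where
`gap_le` reads `γ ≤ μ`. -/
theorem eq_zero_or_le (h : GroundSpace H K γ) {μ : ℝ} (hμ : μ ∈ spectrum ℝ H) :
    μ = 0 ∨ γ ≤ μ := by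
  obtain ⟨v, hv, hHv⟩ := exists_eigenvector h.posSemidef.1 hμ
  refine or_iff_not_imp_left.2 fun h0 => ?_
  have hK : Kᴴ *ᵥ v = 0 := by
    have h1 : Kᴴ *ᵥ (H *ᵥ v) = 0 := by
      rw [mulVec_mulVec, h.conjTranspose_mul_eq_zero, zero_mulVec]
    rw [hHv, mulVec_smul] at h1
    exact (smul_eq_zero.1 h1).resolve_left (by exact_mod_cast h0)
  have h2 := h.gap_le v
  rw [hK, hHv, dotProduct_smul, hv] at h2
  simpa using h2

theorem zero_mem_spectrum [Nonempty m] (h : GroundSpace H K γ) : (0 : ℝ) ∈ spectrum ℝ H := by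
  rw [spectrum.zero_mem_iff]
  intro hu
  have hK : K = 0 := by
    rw [← Matrix.one_mul K, ← hu.val_inv_mul, Matrix.mul_assoc, h.mul_eq_zero, Matrix.mul_zero]
  have h1 := h.isometry
  rw [hK, Matrix.mul_zero] at h1
  obtain ⟨i⟩ := ‹Nonempty m›
  simpa using congr_fun (congr_fun h1 i) i

theorem groundEnergy_eq_zero [Nonempty m] (h : GroundSpace H K γ) : groundEnergy H = 0 :=
  IsLeast.csInf_eq ⟨h.zero_mem_spectrum, fun _ hμ => (h.eq_zero_or_le hμ).elim (fun h => h.ge)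
    h.gap_pos.le.trans⟩

/-- Dimension count: if `H = 0`, then `gap_le` at the basis vectors makes every diagonal entry of `K
K†` at least `1`, so `card m = Tr (K K†)` is at least the full dimension. -/
theorem exists_pos_mem_spectrum (h : GroundSpace H K γ)
    (hcard : Fintype.card m < Fintype.card (ι → Fin 2)) : ∃ μ ∈ spectrum ℝ H, 0 < μ := by
  by_contra! hcon
  have hH : H = 0 := by
    refine h.posSemidef.1.eigenvalues_eq_zero_iff.1 (funext fun i => ?_)
    have hi := h.posSemidef.1.eigenvalues_mem_spectrum_real i
    exact (h.eq_zero_or_le hi).resolve_right fun h1 => absurd (hcon _ hi) (by linarith [h.gap_pos])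
  have h1 : ∀ z : ι → Fin 2, (1 : ℝ) ≤ (K * Kᴴ).trace.re - ∑ w ∈ Finset.univ.erase z,
      ((K * Kᴴ) w w).re := by
    intro z
    have h2 := h.gap_le (Pi.single z 1)
    have h4 : (star (Kᴴ *ᵥ Pi.single z 1) ⬝ᵥ Kᴴ *ᵥ Pi.single z 1) = (K * Kᴴ) z z := by
      rw [star_mulVec, conjTranspose_conjTranspose, ← dotProduct_mulVec, mulVec_mulVec]
      simp
    rw [hH, zero_mulVec, dotProduct_zero, Complex.zero_re, h4] at h2
    have h3 := nonpos_of_mul_nonpos_right h2 h.gap_pos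
    rw [Matrix.trace, Complex.re_sum, ← Finset.add_sum_erase _ _ (Finset.mem_univ z)]
    simp at h3 ⊢
    linarith
  have h5 : (Fintype.card (ι → Fin 2) : ℝ) ≤ (K * Kᴴ).trace.re := by
    rw [Matrix.trace, Complex.re_sum, Fintype.card_eq_sum_ones]
    push_cast
    refine Finset.sum_le_sum fun z _ => ?_
    have := h1 z
    rw [Matrix.trace, Complex.re_sum, ← Finset.add_sum_erase _ _ (Finset.mem_univ z)] at this
    simpa using this
  rw [Matrix.trace_mul_comm, h.isometry, Matrix.trace_one] at h5
  exact absurd hcard (not_lt.2 (by exact_mod_cast h5))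

theorem le_spectralGap [Nonempty m] (h : GroundSpace H K γ)
    (hcard : Fintype.card m < Fintype.card (ι → Fin 2)) : γ ≤ spectralGap H := by
  rw [spectralGap, h.groundEnergy_eq_zero]
  refine le_csInf ?_ ?_
  -- The set of gaps must be nonempty, since `sInf ∅ = 0` would make `spectralGap` vanish.
  · obtain ⟨μ, hμ, h0⟩ := h.exists_pos_mem_spectrum hcard
    exact ⟨_, μ, hμ, h0, rfl⟩
  · rintro _ ⟨μ, hμ, h0, rfl⟩
    rw [sub_zero]
    exact (h.eq_zero_or_le hμ).resolve_left h0.ne'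

theorem spectralGap_le [Nonempty m] (h : GroundSpace H K γ) {μ : ℝ} (hμ : μ ∈ spectrum ℝ H)
    (h0 : 0 < μ) : spectralGap H ≤ μ := by
  rw [spectralGap, h.groundEnergy_eq_zero]
  refine csInf_le ⟨0, ?_⟩ ⟨μ, hμ, h0, (sub_zero μ).symm⟩
  rintro _ ⟨μ, _, h0, rfl⟩
  rw [sub_zero]
  exact h0.le

/-- `H` is bounded below by its spectral gap on the complement of the ground space. -/
theorem posSemidef_sub_gap [Nonempty m] (h : GroundSpace H K γ) :
    (H - (spectralGap H : ℂ) • (1 - K * Kᴴ)).PosSemidef := by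
  set Δ := spectralGap H
  have hM : (H - (Δ : ℂ) • (1 - K * Kᴴ)).IsHermitian := by
    refine h.posSemidef.1.sub ?_
    rw [IsHermitian, conjTranspose_smul, conjTranspose_sub, conjTranspose_one, conjTranspose_mul,
      conjTranspose_conjTranspose]
    simp
  rw [hM.posSemidef_iff_eigenvalues_nonneg]
  intro i
  obtain ⟨v, hv, hMv⟩ := exists_eigenvector hM (hM.eigenvalues_mem_spectrum_real i)
  set μ := hM.eigenvalues i
  simp only [Pi.zero_apply]
  by_contra! hneg
  -- A negative eigenvalue `μ` would have its eigenvector orthogonal to the range of `K`. That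
  -- vector would then be an eigenvector of `H` with eigenvalue `μ + Δ`, positive by `gap_le` yet
  -- smaller than the gap `Δ`.
  have hKM : Kᴴ * (H - (Δ : ℂ) • (1 - K * Kᴴ)) = 0 := by
    rw [Matrix.mul_sub, h.conjTranspose_mul_eq_zero, Matrix.mul_smul, Matrix.mul_sub,
      ← Matrix.mul_assoc,
      h.isometry]
    simp
  have hK : Kᴴ *ᵥ v = 0 := by
    have h1 := congr_arg (Kᴴ *ᵥ ·) hMv
    simp only [mulVec_mulVec, hKM, zero_mulVec, mulVec_smul] at h1
    exact (smul_eq_zero.1 h1.symm).resolve_left (by exact_mod_cast hneg.ne)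
  have hHv : H *ᵥ v = ((μ + Δ : ℝ) : ℂ) • v := by
    rw [sub_mulVec, smul_mulVec, sub_mulVec, one_mulVec, ← mulVec_mulVec, hK, mulVec_zero,
      sub_zero, sub_eq_iff_eq_add] at hMv
    rw [hMv, Complex.ofReal_add, add_smul]
  have hpos : 0 < μ + Δ := by
    have h2 := h.gap_le v
    rw [hK, hHv, dotProduct_smul, hv] at h2
    simp at h2
    linarith [h.gap_pos]
  have hmem : μ + Δ ∈ spectrum ℝ H := by
    rw [spectrum.mem_iff]
    intro hu
    have h3 : (algebraMap ℝ (Op ι) (μ + Δ) - H) *ᵥ v = 0 := by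
      rw [sub_mulVec, hHv, Algebra.algebraMap_eq_smul_one, smul_mulVec, one_mulVec]
      ext; simp
    have h4 : v = 0 := by
      rw [← one_mulVec v, ← hu.val_inv_mul, ← mulVec_mulVec, h3, mulVec_zero]
    rw [h4] at hv
    simp at hv
  linarith [h.spectralGap_le hmem hpos]

theorem gap_mul_le_energy [Nonempty m] (h : GroundSpace H K γ) {ρ : Op ι} (hρ : IsState ρ) :
    spectralGap H * (1 - (K * Kᴴ * ρ).trace.re) ≤ energy H ρ := by
  have h1 := trace_mul_nonneg h.posSemidef_sub_gap hρ.1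
  rw [sub_mul, trace_sub, Matrix.smul_mul, trace_smul, sub_mul, one_mul, trace_sub, hρ.2,
    smul_eq_mul, Complex.sub_re, Complex.re_ofReal_mul] at h1
  simpa [energy] using h1

/-- Low-energy states are close to the ground space: a state of energy at most `β` either
excludes nothing, or its normalized projection to the ground space approximates it in all
expectations of Hermitian unitaries. -/
theorem exists_ground_state {κ : Type} [Fintype κ] [DecidableEq κ]
    {K : Matrix (ι → Fin 2) (κ → Fin 2) ℂ} (h : GroundSpace H K γ) (hΔ : 0 < spectralGap H)
    {ρ : Op ι} (hρ : IsState ρ) {β : ℝ} (hβ : energy H ρ ≤ β) :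
    ∃ σ : Op κ, IsState σ ∧ (IsPure ρ → IsPure σ) ∧
      ∀ Q : Op ι, Q.IsHermitian → Q * Q = 1 →
        (Q * (ρ - K * σ * Kᴴ)).trace.re ≤ 2 * √(β / spectralGap H) := by
  have hle : 1 - (K * Kᴴ * ρ).trace.re ≤ β / spectralGap H := by
    rw [le_div_iff₀ hΔ, mul_comm]
    exact (h.gap_mul_le_energy hρ).trans hβ
  have hpsd : (Kᴴ * ρ * K).PosSemidef := hρ.1.conjTranspose_mul_mul_same K
  have htr : (K * Kᴴ * ρ).trace = (Kᴴ * ρ * K).trace := by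
    rw [Matrix.mul_assoc, Matrix.trace_mul_comm]
  obtain ⟨h0, him⟩ := Complex.le_def.1 hpsd.trace_nonneg
  set p := (Kᴴ * ρ * K).trace.re
  have hp : (Kᴴ * ρ * K).trace = p := Complex.ext rfl (by simpa using him.symm)
  rw [htr] at hle
  -- `p` is the weight of `ρ` on the ground space. If `p = 0`, then `β/Δ ≥ 1`, so the bound is at
  -- least `2` and any pure `σ` will do.
  rcases h0.eq_or_lt with h0 | h0
  · obtain ⟨σ, hσ, hpure⟩ := exists_isState_isPure κ
    refine ⟨σ, hσ, fun _ => hpure, fun Q hQ hQQ => ?_⟩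
    have h1 := hρ.trace_mul_le_one hQ hQQ
    have h2 := (hσ.conj h.isometry).neg_one_le_trace_mul hQ hQQ
    have h3 : 1 ≤ √(β / spectralGap H) := by
      rw [Real.one_le_sqrt]
      have : p = 0 := by simpa using h0.symm
      linarith
    rw [mul_sub, trace_sub, Complex.sub_re]
    linarith
  · replace h0 : 0 < p := by simpa using h0
    have hinv : (0 : ℂ) ≤ ((p⁻¹ : ℝ) : ℂ) := by
      rw [Complex.zero_le_real]; positivity
    -- The pullback of the normalized projection: `K σ K† = p⁻¹ P ρ P` with `P = K K†`, which is the
    -- state in `gentle_measurement`.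
    refine ⟨((p⁻¹ : ℝ) : ℂ) • (Kᴴ * ρ * K), ⟨hpsd.smul hinv, ?_⟩, ?_, fun Q hQ hQQ => ?_⟩
    · rw [trace_smul, hp, smul_eq_mul, ← Complex.ofReal_mul, inv_mul_cancel₀ h0.ne',
        Complex.ofReal_one]
    · rintro ⟨ψ, hψ, rfl⟩
      have hs : ((√p)⁻¹ : ℝ) * (√p)⁻¹ = p⁻¹ := by rw [← mul_inv, Real.mul_self_sqrt h0.le]
      have hv : Kᴴ * vecMulVec ψ (star ψ) * K = vecMulVec (Kᴴ *ᵥ ψ) (star (Kᴴ *ᵥ ψ)) := by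
        simpa using conj_vecMulVec Kᴴ ψ
      refine ⟨(((√p)⁻¹ : ℝ) : ℂ) • (Kᴴ *ᵥ ψ), ?_, ?_⟩
      · rw [hv, trace_vecMulVec, dotProduct_comm] at hp
        rw [star_smul, smul_dotProduct, dotProduct_smul, hp, smul_smul, smul_eq_mul,
          Complex.star_def, Complex.conj_ofReal, ← Complex.ofReal_mul, hs, ← Complex.ofReal_mul,
          inv_mul_cancel₀ h0.ne', Complex.ofReal_one]
      · rw [hv, star_smul, vecMulVec_smul, smul_vecMulVec, smul_smul, Complex.star_def,
          Complex.conj_ofReal, ← Complex.ofReal_mul, hs]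
    · have h1 : K * (((p⁻¹ : ℝ) : ℂ) • (Kᴴ * ρ * K)) * Kᴴ =
          ((p⁻¹ : ℝ) : ℂ) • (K * Kᴴ * ρ * (K * Kᴴ)) := by
        rw [Matrix.mul_smul, Matrix.smul_mul]
        simp only [Matrix.mul_assoc]
      rw [h1]
      refine (gentle_measurement hρ.1 hρ.2 (isHermitian_mul_conjTranspose_self K) ?_ hQ hQQ
        (htr.trans hp) h0).trans ?_
      · rw [Matrix.mul_assoc, ← Matrix.mul_assoc Kᴴ, h.isometry, Matrix.one_mul]
      · gcongr

end GroundSpace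

end Gap

/-! ### Locality -/

section Locality

variable {ι κ : Type} [Fintype ι] [DecidableEq ι] [Fintype κ] [DecidableEq κ]

/-- An entrywise criterion with no auxiliary `M'`: entries vanish off the diagonal outside `S`, and
otherwise depend only on the coordinates in `S`. The closure properties below become index checks.
-/
theorem actsOn_iff {M : Op ι} {S : Finset ι} :
    ActsOn M S ↔ (∀ x y, (∃ i ∉ S, x i ≠ y i) → M x y = 0) ∧
      ∀ x y x' y' : ι → Fin 2, (∀ i ∉ S, x i = y i) → (∀ i ∉ S, x' i = y' i) →
        (∀ i ∈ S, x i = x' i) → (∀ i ∈ S, y i = y' i) → M x y = M x' y' := by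
  constructor
  · rintro ⟨M', hM⟩
    refine ⟨fun x y ⟨i, hi, h⟩ => ?_, fun x y x' y' h h' hx hy => ?_⟩
    · rw [hM, if_neg fun hc => h (hc i hi)]
    · rw [hM, hM, if_pos h, if_pos h']
      congr 1
      · exact funext fun i => hx i i.2
      · exact funext fun i => hy i i.2
  · rintro ⟨h0, h1⟩
    refine ⟨fun a b => M (fun i => if h : i ∈ S then a ⟨i, h⟩ else 0)
      (fun i => if h : i ∈ S then b ⟨i, h⟩ else 0), fun x y => ?_⟩
    split_ifs with h
    · exact h1 _ _ _ _ h (fun i hi => by simp [hi]) (fun i hi => by simp [hi])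
        (fun i hi => by simp [hi])
    · push Not at h
      exact h0 _ _ h

theorem ActsOn.mono {M : Op ι} {S S' : Finset ι} (h : ActsOn M S) (hS : S ⊆ S') :
    ActsOn M S' := by
  rw [actsOn_iff] at h ⊢
  refine ⟨fun x y ⟨i, hi, hxy⟩ => h.1 x y ⟨i, fun hc => hi (hS hc), hxy⟩,
    fun x y x' y' hn hn' hx hy => ?_⟩
  by_cases hc : ∀ i ∉ S, x i = y i
  · refine h.2 x y x' y' hc (fun i hi => ?_) (fun i hi => hx i (hS hi)) fun i hi => hy i (hS hi)
    by_cases hi' : i ∈ S'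
    · rw [← hx i hi', ← hy i hi', hc i hi]
    · exact hn' i hi'
  · push Not at hc
    obtain ⟨i, hi, hne⟩ := hc
    have hi' : i ∈ S' := by
      by_contra hi'
      exact hne (hn i hi')
    rw [h.1 x y ⟨i, hi, hne⟩, h.1 x' y' ⟨i, hi, by rwa [← hx i hi', ← hy i hi']⟩]

theorem ActsOn.add {M N : Op ι} {S : Finset ι} (hM : ActsOn M S) (hN : ActsOn N S) :
    ActsOn (M + N) S := by
  rw [actsOn_iff] at hM hN ⊢
  exact ⟨fun x y h => by simp [hM.1 x y h, hN.1 x y h], fun x y x' y' h h' hx hy => by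
    simp [hM.2 x y x' y' h h' hx hy, hN.2 x y x' y' h h' hx hy]⟩

theorem ActsOn.neg {M : Op ι} {S : Finset ι} (hM : ActsOn M S) : ActsOn (-M) S := by
  rw [actsOn_iff] at hM ⊢
  exact ⟨fun x y h => by simp [hM.1 x y h], fun x y x' y' h h' hx hy => by
    simp [hM.2 x y x' y' h h' hx hy]⟩

theorem ActsOn.sub {M N : Op ι} {S : Finset ι} (hM : ActsOn M S) (hN : ActsOn N S) :
    ActsOn (M - N) S := by
  rw [sub_eq_add_neg]
  exact hM.add hN.neg

theorem ActsOn.conjTranspose {M : Op ι} {S : Finset ι} (hM : ActsOn M S) : ActsOn Mᴴ S := by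
  rw [actsOn_iff] at hM ⊢
  refine ⟨fun x y ⟨i, hi, h⟩ => ?_, fun x y x' y' h h' hx hy => ?_⟩
  · rw [conjTranspose_apply, hM.1 y x ⟨i, hi, h.symm⟩, star_zero]
  · rw [conjTranspose_apply, conjTranspose_apply, hM.2 y x y' x' (fun i hi => (h i hi).symm)
      (fun i hi => (h' i hi).symm) hy hx]

theorem actsOn_diagonal {d : (ι → Fin 2) → ℂ} {S : Finset ι}
    (h : ∀ x x' : ι → Fin 2, (∀ i ∈ S, x i = x' i) → d x = d x') : ActsOn (diagonal d) S := by
  rw [actsOn_iff]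
  refine ⟨fun x y ⟨i, _, hne⟩ => diagonal_apply_ne _ fun hc => hne (by rw [hc]),
    fun x y x' y' hn hn' hx hy => ?_⟩
  by_cases hxy : x = y
  · have : x' = y' := by
      funext i
      by_cases hi : i ∈ S
      · rw [← hx i hi, ← hy i hi, hxy]
      · exact hn' i hi
    rw [← hxy, ← this, diagonal_apply_eq, diagonal_apply_eq, h x x' hx]
  · have : x' ≠ y' := by
      rintro rfl
      refine hxy (funext fun i => ?_)
      by_cases hi : i ∈ S
      · rw [hx i hi, hy i hi]
      · exact hn i hi
    rw [diagonal_apply_ne _ hxy, diagonal_apply_ne _ this]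

theorem actsOn_one (S : Finset ι) : ActsOn (1 : Op ι) S := by
  rw [← diagonal_one]
  exact actsOn_diagonal fun _ _ _ => rfl

theorem ActsOn.tensor {M : Op ι} {N : Op κ} {S : Finset ι} {S' : Finset κ} (hM : ActsOn M S)
    (hN : ActsOn N S') : ActsOn (tensor M N) (S.disjSum S') := by
  rw [actsOn_iff] at hM hN ⊢
  constructor
  · rintro x y ⟨i | i, hi, hne⟩
    · rw [QHam.tensor, hM.1 _ _ ⟨i, by simpa using hi, hne⟩, zero_mul]
    · rw [QHam.tensor, hN.1 _ _ ⟨i, by simpa using hi, hne⟩, mul_zero]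
  · intro x y x' y' h h' hx hy
    rw [QHam.tensor, QHam.tensor]
    congr 1
    · exact hM.2 _ _ _ _ (fun i hi => h _ (by simpa using hi))
        (fun i hi => h' _ (by simpa using hi))
        (fun i hi => hx _ (by simpa using hi)) (fun i hi => hy _ (by simpa using hi))
    · exact hN.2 _ _ _ _ (fun i hi => h _ (by simpa using hi))
        (fun i hi => h' _ (by simpa using hi))
        (fun i hi => hx _ (by simpa using hi)) (fun i hi => hy _ (by simpa using hi))

theorem IsLocalHamiltonian.of_actsOn {k : ℕ} {H : Op ι} {S : Finset ι} (hH : H.IsHermitian)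
    (hS : S.card ≤ k) (h : ActsOn H S) : IsLocalHamiltonian k H :=
  ⟨1, fun _ => H, fun _ => ⟨hH, S, hS, h⟩, by simp⟩

theorem IsLocalHamiltonian.add {k : ℕ} {H H' : Op ι} (h : IsLocalHamiltonian k H)
    (h' : IsLocalHamiltonian k H') : IsLocalHamiltonian k (H + H') := by
  obtain ⟨m, f, hf, rfl⟩ := h
  obtain ⟨m', f', hf', rfl⟩ := h'
  refine ⟨m + m', Fin.append f f', fun j => ?_, by simp [Fin.sum_univ_add]⟩
  refine Fin.addCases (fun i => ?_) (fun i => ?_) j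
  · simpa using hf i
  · simpa using hf' i

theorem IsLocalHamiltonian.sum {k : ℕ} {α : Type*} {s : Finset α} {H : α → Op ι}
    (h : ∀ a ∈ s, IsLocalHamiltonian k (H a)) : IsLocalHamiltonian k (∑ a ∈ s, H a) :=
  Finset.sum_induction H (IsLocalHamiltonian k) (fun _ _ => IsLocalHamiltonian.add)
    ⟨0, Fin.elim0, fun j => j.elim0, by simp⟩ h

end Locality

/-! ### Locality of the channel Hamiltonian -/

section ClockLocality

variable {N : ℕ}

theorem clockBit_succ (c : Fin N → Fin 2) {i : ℕ} (h : i < N) :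
    clockBit c (i + 1) = c ⟨i, h⟩ := by
  simp [clockBit, h]

theorem clockBit_succ_of_le (c : Fin N → Fin 2) {i : ℕ} (h : N ≤ i) :
    clockBit c (i + 1) = 0 := by
  simp [clockBit, h]

/-- The clock qubits among `C_i, …, C_{j-1}`. -/
def clockWindow (N i j : ℕ) : Finset (Fin N) :=
  Finset.univ.filter fun k => i ≤ (k : ℕ) + 1 ∧ (k : ℕ) + 1 < j

theorem card_clockWindow_le (N i j : ℕ) : (clockWindow N i j).card ≤ j - i := by
  have := Finset.card_le_card_of_injOn (s := clockWindow N i j) (t := Finset.Ico i j)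
    (fun k => (k : ℕ) + 1) (fun k hk => by simpa [clockWindow] using hk)
    (fun a _ b _ h => Fin.ext (by simpa using h))
  simpa using this

theorem clockBit_congr {i j l : ℕ} {c c' : Fin N → Fin 2}
    (h : ∀ k ∈ clockWindow N i j, c k = c' k) (hi : i ≤ l) (hj : l < j) :
    clockBit c l = clockBit c' l := by
  cases l with
  | zero => rfl
  | succ l =>
    by_cases hl : l < N
    · rw [clockBit_succ _ hl, clockBit_succ _ hl]
      exact h _ (by simp [clockWindow, hi, hj])
    · rw [clockBit_succ_of_le _ (not_lt.1 hl), clockBit_succ_of_le _ (not_lt.1 hl)]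

theorem actsOn_clockProj (t : ℕ) : ActsOn (clockProj N t) (clockWindow N t (t + 2)) :=
  actsOn_diagonal fun c c' h => by
    rw [clockBit_congr h le_rfl (by omega), clockBit_congr h (l := t + 1) (by omega) (by omega)]

theorem actsOn_clockPenalty (i : ℕ) : ActsOn (clockPenalty N i) (clockWindow N i (i + 2)) :=
  actsOn_diagonal fun c c' h => by
    rw [clockBit_congr h le_rfl (by omega), clockBit_congr h (l := i + 1) (by omega) (by omega)]

theorem clockWindow_mono {i j i' j' : ℕ} (hi : i' ≤ i) (hj : j ≤ j') :
    clockWindow N i j ⊆ clockWindow N i' j' := by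
  intro k
  simp only [clockWindow, Finset.mem_filter_univ]
  omega

theorem actsOn_clockRaise (t : ℕ) :
    ActsOn (clockRaise N t) (clockWindow N t (t + 3)) := by
  rw [actsOn_iff]
  constructor
  · rintro x y ⟨i, hi, hne⟩
    refine if_neg fun hc => hne (hc.2.2.2.2 i fun hit => hi ?_)
    simp only [clockWindow, Finset.mem_filter_univ]
    omega
  · intro x y x' y' h h' hx hy
    rw [clockRaise, clockRaise, clockBit_congr hy le_rfl (by omega),
      clockBit_congr hy (l := t + 1) (by omega) (by omega),
      clockBit_congr hy (l := t + 2) (by omega) (by omega),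
      clockBit_congr hx (l := t + 1) (by omega) (by omega)]
    congr! 6 with i
    refine imp_congr_right fun _ => ?_
    by_cases hi : i ∈ clockWindow N t (t + 3)
    · rw [hx i hi, hy i hi]
    · exact iff_of_true (h i hi) (h' i hi)

theorem isHermitian_clockProj (N t : ℕ) : (clockProj N t).IsHermitian :=
  isHermitian_diagonal_of_self_adjoint _ (funext fun c => by
    by_cases h : clockBit c t = 1 ∧ clockBit c (t + 1) = 0 <;> simp [h])

theorem isHermitian_clockPenalty (N i : ℕ) : (clockPenalty N i).IsHermitian :=
  isHermitian_diagonal_of_self_adjoint _ (funext fun c => by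
    by_cases h : clockBit c i = 0 ∧ clockBit c (i + 1) = 1 <;> simp [h])

theorem isHermitian_oneProj {ι : Type} [Fintype ι] [DecidableEq ι] (q : ι) :
    (oneProj q).IsHermitian :=
  isHermitian_diagonal_of_self_adjoint _ (funext fun c => by
    by_cases h : c q = 1 <;> simp [h])

theorem IsHermitian.tensor {ι κ : Type} {M : Op ι} {N : Op κ} (hM : M.IsHermitian)
    (hN : N.IsHermitian) : (tensor M N).IsHermitian := by
  rw [IsHermitian, tensor_conjTranspose, hM.eq, hN.eq]

theorem isLocalHamiltonian_hIn (nA nB N : ℕ) : IsLocalHamiltonian 5 (hIn nA nB N) := by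
  refine IsLocalHamiltonian.sum fun q _ => ?_
  have hq : ActsOn (oneProj (Sum.inr q : Work nA nB)) {Sum.inr q} :=
    actsOn_diagonal fun x x' h => by rw [h _ (Finset.mem_singleton_self _)]
  refine .of_actsOn (IsHermitian.tensor (isHermitian_oneProj _) (isHermitian_clockProj _ _)) ?_
    (hq.tensor (actsOn_clockProj 0))
  have := card_clockWindow_le N 0 (0 + 2)
  rw [Finset.card_disjSum, Finset.card_singleton]
  omega

theorem isLocalHamiltonian_hClock (nA nB N : ℕ) : IsLocalHamiltonian 5 (hClock nA nB N) := by
  refine IsLocalHamiltonian.sum fun i _ => ?_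
  refine .of_actsOn (IsHermitian.tensor isHermitian_one (isHermitian_clockPenalty _ _)) ?_
    ((actsOn_one ∅).tensor (actsOn_clockPenalty i))
  have := card_clockWindow_le N i (i + 2)
  rw [Finset.card_disjSum, Finset.card_empty]
  omega

/-- Each whole time step is one local term, because the hopping operators need not be Hermitian
separately. Two gate qubits and the three clock qubits `C_t C_{t+1} C_{t+2}` give `5`. -/
theorem isLocalHamiltonian_hProp {nA nB T : ℕ} {V : Fin T → Op (Work nA nB)}
    (hV : ∀ t, IsGate (V t)) (L : ℕ) : IsLocalHamiltonian 5 (hProp V L) := by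
  refine IsLocalHamiltonian.sum fun t _ => ?_
  obtain ⟨S, hS, hact⟩ : ∃ S : Finset (Work nA nB), S.card ≤ 2 ∧ ActsOn (gateAt V t) S := by
    rw [gateAt]
    split_ifs with h
    · exact (hV _).2
    · exact ⟨∅, by simp, actsOn_one _⟩
  have hr := hact.tensor (actsOn_clockRaise (N := T + L) t)
  have hsub : ∀ i j : ℕ, t ≤ i → j ≤ t + 3 →
      (∅ : Finset (Work nA nB)).disjSum (clockWindow (T + L) i j) ⊆
        S.disjSum (clockWindow (T + L) t (t + 3)) := fun i j hi hj =>
    Finset.disjSum_mono (Finset.empty_subset _) (clockWindow_mono hi hj)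
  have hp : ∀ s : ℕ, t ≤ s → s ≤ t + 1 → ActsOn (tensor (1 : Op (Work nA nB))
      (clockProj (T + L) s)) (S.disjSum (clockWindow (T + L) t (t + 3))) := fun s h1 h2 =>
    ((actsOn_one ∅).tensor (actsOn_clockProj s)).mono (hsub _ _ h1 (by omega))
  refine .of_actsOn ?_ ?_ (((hr.neg.sub ?_).add (hp t le_rfl (by omega))).add
    (hp (t + 1) (by omega) le_rfl))
  · have h1 : ∀ s, (tensor (1 : Op (Work nA nB)) (clockProj (T + L) s)).IsHermitian := fun s =>
      IsHermitian.tensor isHermitian_one (isHermitian_clockProj _ s)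
    refine (IsHermitian.add ?_ (h1 _)).add (h1 _)
    rw [← tensor_conjTranspose, IsHermitian, conjTranspose_sub, conjTranspose_neg,
      conjTranspose_conjTranspose]
    abel
  · have := card_clockWindow_le (T + L) t (t + 3)
    rw [Finset.card_disjSum]
    omega
  · rw [← tensor_conjTranspose]
    exact hr.conjTranspose

theorem isLocalHamiltonian_channelHamiltonian {nA nB T : ℕ} {V : Fin T → Op (Work nA nB)}
    (hV : ∀ t, IsGate (V t)) (L : ℕ) : IsLocalHamiltonian 5 (channelHamiltonian V L) :=
  ((isLocalHamiltonian_hIn _ _ _).add (isLocalHamiltonian_hProp hV L)).add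
    (isLocalHamiltonian_hClock _ _ _)

end ClockLocality

/-! ### Unary clock strings -/

section Clock

variable {N : ℕ}

/-- The clock string `1^t 0^(N-t)`. -/
def unary (N t : ℕ) : Fin N → Fin 2 := fun i => if (i : ℕ) < t then 1 else 0

theorem clockBit_unary {t : ℕ} (ht : t ≤ N) (i : ℕ) :
    clockBit (unary N t) i = if i ≤ t then 1 else 0 := by
  cases i with
  | zero => simp [clockBit]
  | succ i =>
    by_cases h : i < N
    · rw [clockBit_succ _ h]
      simp [unary]
    · rw [clockBit_succ_of_le _ (not_lt.1 h), if_neg (by omega)]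

theorem unary_inj {s t : ℕ} (hs : s ≤ N) (ht : t ≤ N) : unary N s = unary N t ↔ s = t := by
  refine ⟨fun h => ?_, fun h => h ▸ rfl⟩
  have key : ∀ i, i ≤ s ↔ i ≤ t := fun i => by
    have h1 := clockBit_unary hs i
    rw [h, clockBit_unary ht] at h1
    by_cases a : i ≤ s <;> by_cases b : i ≤ t <;> simp [a, b] at h1 ⊢
  exact le_antisymm ((key s).1 le_rfl) ((key t).2 le_rfl)

/-- A clock string without the pattern `01` encodes a time. -/
theorem exists_eq_unary {c : Fin N → Fin 2}
    (h : ∀ i ∈ Finset.Ico 1 N, ¬ (clockBit c i = 0 ∧ clockBit c (i + 1) = 1)) :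
    ∃ t ≤ N, c = unary N t := by
  have h01 : ∀ a : Fin 2, a ≠ 1 → a = 0 := by decide
  have hstep : ∀ i, clockBit c i = 0 → clockBit c (i + 1) = 0 := by
    intro i hi
    by_cases hN : i < N
    · refine h01 _ fun h1 => h i (Finset.mem_Ico.2 ⟨Nat.one_le_iff_ne_zero.2 ?_, hN⟩) ⟨hi, h1⟩
      rintro rfl
      simp [clockBit] at hi
    · exact clockBit_succ_of_le _ (not_lt.1 hN)
  have hex : ∃ i, clockBit c (i + 1) = 0 := ⟨N, clockBit_succ_of_le _ le_rfl⟩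
  classical
  -- The time is the position of the first `0`, which exists by the convention `C_{N+1} = 0`.
  -- Without the pattern `01`, every later bit is `0` as well.
  refine ⟨Nat.find hex, Nat.find_min' hex (clockBit_succ_of_le _ le_rfl), funext fun i => ?_⟩
  rw [unary, ← clockBit_succ c i.2]
  split_ifs with hi
  · by_contra h1
    exact Nat.find_min hex hi (h01 _ h1)
  · exact Nat.le_induction (Nat.find_spec hex) (fun _ _ => hstep _) _ (not_lt.1 hi)

/-- The strings that encode a time. -/
def legalClock (N : ℕ) : Finset (Fin N → Fin 2) := (Finset.range (N + 1)).image (unary N)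

theorem sum_clock {α : Type*} [AddCommMonoid α] (f : (Fin N → Fin 2) → α) :
    ∑ c, f c = ∑ t ∈ Finset.range (N + 1), f (unary N t) + ∑ c ∈ (legalClock N)ᶜ, f c := by
  rw [← Finset.sum_add_sum_compl (legalClock N), legalClock, Finset.sum_image]
  intro s hs t ht h
  rw [Finset.mem_coe, Finset.mem_range, Nat.lt_succ_iff] at hs ht
  exact (unary_inj hs ht).1 h

/-! ### Clock operators -/

/-- The projector onto `C_t C_{t+1} C_{t+2} = abd`. -/
def clockPattern (N t : ℕ) (a b d : Fin 2) : Op (Fin N) :=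
  diagonal fun c => if clockBit c t = a ∧ clockBit c (t + 1) = b ∧ clockBit c (t + 2) = d
    then 1 else 0

/-- Splitting by the third bit isolates `100`, the initial pattern of `clockRaise`; the remainder
`101` is illegal. -/
theorem clockProj_eq (N t : ℕ) :
    clockProj N t = clockPattern N t 1 0 0 + clockPattern N t 1 0 1 := by
  rw [clockProj, clockPattern, clockPattern, diagonal_add]
  congr 1; funext c
  generalize clockBit c t = a; generalize clockBit c (t + 1) = b
  generalize clockBit c (t + 2) = d
  fin_cases a <;> fin_cases b <;> fin_cases d <;> simp

theorem clockProj_succ_eq (N t : ℕ) :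
    clockProj N (t + 1) = clockPattern N t 1 1 0 + clockPattern N t 0 1 0 := by
  rw [clockProj, clockPattern, clockPattern, diagonal_add]
  congr 1; funext c
  generalize clockBit c t = a; generalize clockBit c (t + 1) = b
  generalize clockBit c (t + 1 + 1) = d
  fin_cases a <;> fin_cases b <;> fin_cases d <;> simp

theorem clockBit_congr_of_ne {t : ℕ} {c c' : Fin N → Fin 2}
    (h : ∀ i : Fin N, (i : ℕ) ≠ t → c i = c' i) {i : ℕ} (hi : i ≠ t + 1) :
    clockBit c i = clockBit c' i := by
  cases i with
  | zero => rfl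
  | succ i =>
    by_cases hN : i < N
    · rw [clockBit_succ _ hN, clockBit_succ _ hN]
      exact h _ (by simpa using hi)
    · rw [clockBit_succ_of_le _ (not_lt.1 hN), clockBit_succ_of_le _ (not_lt.1 hN)]

theorem clockRaise_mul_clockPattern (N t : ℕ) :
    clockRaise N t * clockPattern N t 1 0 0 = clockRaise N t := by
  ext x y
  rw [clockPattern, mul_diagonal, clockRaise]
  split_ifs <;> simp_all

theorem clockRaise_apply {t : ℕ} (ht : t < N) (x y : Fin N → Fin 2) :
    clockRaise N t x y = if (clockBit x t = 1 ∧ clockBit x (t + 1) = 1 ∧ clockBit x (t + 2) = 0) ∧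
      y = Function.update x ⟨t, ht⟩ 0 then 1 else 0 := by
  rw [clockRaise]
  refine if_congr ⟨?_, ?_⟩ rfl rfl
  · rintro ⟨h1, h2, h3, h4, h5⟩
    rw [clockBit_congr_of_ne h5 (by omega), clockBit_congr_of_ne h5 (i := t + 2) (by omega)]
    refine ⟨⟨h1, h4, h3⟩, funext fun i => ?_⟩
    by_cases hi : i = ⟨t, ht⟩
    · subst hi
      rw [Function.update_self, ← h2, clockBit_succ _ ht]
    · rw [Function.update_of_ne hi, h5]
      exact fun hc => hi (Fin.ext hc)
  · rintro ⟨⟨h1, h2, h3⟩, rfl⟩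
    have h5 : ∀ i : Fin N, (i : ℕ) ≠ t → x i = Function.update x ⟨t, ht⟩ 0 i := fun i hi => by
      rw [Function.update_of_ne fun hc => hi (by rw [hc])]
    rw [← clockBit_congr_of_ne h5 (by omega), ← clockBit_congr_of_ne h5 (i := t + 2) (by omega)]
    exact ⟨h1, by rw [clockBit_succ _ ht, Function.update_self], h3, h2, h5⟩

/-- The raising operator is a partial isometry from the pattern `100` onto `110`: it flips one bit
and is injective there. -/
theorem clockRaise_mul_conjTranspose {t : ℕ} (ht : t < N) :
    clockRaise N t * (clockRaise N t)ᴴ = clockPattern N t 1 1 0 := by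
  ext x y
  rw [Matrix.mul_apply, clockPattern]
  simp only [conjTranspose_apply, clockRaise_apply ht]
  by_cases hxy : x = y
  · subst hxy
    rw [diagonal_apply_eq, Finset.sum_eq_single (Function.update x ⟨t, ht⟩ 0)]
    · simp only [and_true]
      split_ifs <;> simp
    · intro z _ hz; simp [hz]
    · simp
  · rw [diagonal_apply_ne _ hxy]
    refine Finset.sum_eq_zero fun z _ => ?_
    by_contra hne
    have hx' := left_ne_zero_of_mul hne
    have hy' := right_ne_zero_of_mul hne
    rw [star_ne_zero] at hy'
    obtain ⟨⟨-, hx, -⟩, hz'⟩ := (ite_ne_right_iff.1 hx').1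
    obtain ⟨⟨-, hy, -⟩, hz⟩ := (ite_ne_right_iff.1 hy').1
    refine absurd (funext fun i => ?_) hxy
    rw [clockBit_succ _ ht] at hx hy
    by_cases hi : i = ⟨t, ht⟩
    · rw [hi, hx, hy]
    · have := congr_fun (hz'.symm.trans hz) i
      rwa [Function.update_of_ne hi, Function.update_of_ne hi] at this

theorem clockRaise_apply_unary {s t : ℕ} (ht : t < N) (hs : s ≤ N) (c : Fin N → Fin 2) :
    clockRaise N t (unary N s) c = if s = t + 1 ∧ c = unary N t then 1 else 0 := by
  rw [clockRaise_apply ht]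
  have h1 : (clockBit (unary N s) t = 1 ∧ clockBit (unary N s) (t + 1) = 1 ∧
      clockBit (unary N s) (t + 2) = 0) ↔ s = t + 1 := by
    simp only [clockBit_unary hs]
    simp
    omega
  refine if_congr ((and_congr_left' h1).trans (and_congr_right fun h => ?_)) rfl rfl
  have : Function.update (unary N s) ⟨t, ht⟩ 0 = unary N t := by
    funext i
    by_cases hi : i = ⟨t, ht⟩
    · subst hi; simp [unary]
    · have : (i : ℕ) ≠ t := fun hc => hi (Fin.ext hc)
      rw [Function.update_of_ne hi, unary, unary]
      congr 1
      simp only [eq_iff_iff]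
      omega
  rw [this]

theorem clockPattern_one_zero_zero_unary {t : ℕ} (ht : t ≤ N) :
    clockPattern N t 1 0 0 (unary N t) (unary N t) = 1 := by
  simp [clockPattern, clockBit_unary ht]

end Clock

/-! ### Operators on the working register and the clock -/

section Slices

variable {ι κ : Type} [Fintype ι] [DecidableEq ι] [Fintype κ] [DecidableEq κ]
  {m : Type} [Fintype m] [DecidableEq m]

/-- The component of a vector with the clock in the basis state `c`. -/
def slice {ι κ : Type} (v : (ι ⊕ κ → Fin 2) → ℂ) (c : κ → Fin 2) : (ι → Fin 2) → ℂ :=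
  fun x => v (Sum.elim x c)

/-- The matrix `G ⊗ |c⟩`. -/
def block {ι m : Type} (G : Matrix (ι → Fin 2) m ℂ) (c : κ → Fin 2) :
    Matrix (ι ⊕ κ → Fin 2) m ℂ :=
  fun z a => if z ∘ Sum.inr = c then G (z ∘ Sum.inl) a else 0

@[simp] theorem block_elim {ι m : Type} (G : Matrix (ι → Fin 2) m ℂ) (c c' : κ → Fin 2)
    (x : ι → Fin 2) (a : m) :
    block G c (Sum.elim x c') a = if c' = c then G x a else 0 := rfl

theorem conjTranspose_block_mulVec (G : Matrix (ι → Fin 2) m ℂ) (c : κ → Fin 2)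
    (v : (ι ⊕ κ → Fin 2) → ℂ) : (block G c)ᴴ *ᵥ v = Gᴴ *ᵥ slice v c := by
  ext a
  simp [mulVec, dotProduct, sum_sum_elim, slice, apply_ite, ite_mul]

theorem conjTranspose_block_mul_block (G G' : Matrix (ι → Fin 2) m ℂ) (c c' : κ → Fin 2) :
    (block G c)ᴴ * block G' c' = if c = c' then Gᴴ * G' else 0 := by
  ext a b
  split_ifs with h
  · subst h
    simp [Matrix.mul_apply, sum_sum_elim, apply_ite, ite_mul]
  · simp [Matrix.mul_apply, sum_sum_elim, apply_ite, ite_mul, Ne.symm h]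

theorem traceRight_block (G G' : Matrix (ι → Fin 2) m ℂ) (c c' : κ → Fin 2)
    (σ : Matrix m m ℂ) :
    traceRight (block G c * σ * (block G' c')ᴴ) = if c = c' then G * σ * G'ᴴ else 0 := by
  ext x y
  split_ifs with h
  · subst h
    simp only [traceRight, Matrix.mul_apply, conjTranspose_apply, block_elim]
    rw [Finset.sum_eq_single c (fun b _ hb => by simp [hb]) (by simp)]
    simp
  · simp only [traceRight, Matrix.mul_apply, conjTranspose_apply, block_elim]
    refine Finset.sum_eq_zero fun b _ => Finset.sum_eq_zero fun a _ => ?_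
    by_cases hb : b = c
    · subst hb; simp [h]
    · simp [hb]

theorem tensor_mul_block (A : Op ι) (B : Op κ) (G : Matrix (ι → Fin 2) m ℂ) (c : κ → Fin 2) :
    tensor A B * block G c = ∑ c', B c' c • block (A * G) c' := by
  ext z a
  obtain ⟨x, d, rfl⟩ : ∃ x d, z = Sum.elim x d := ⟨_, _, (Sum.elim_comp_inl_inr z).symm⟩
  simp only [Matrix.mul_apply, Matrix.sum_apply, sum_sum_elim, tensor_elim, block_elim,
    Matrix.smul_apply, smul_eq_mul, mul_ite, mul_zero, Finset.sum_ite_eq, Finset.sum_ite_eq',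
    Finset.mem_univ, if_true, Finset.mul_sum]
  exact Finset.sum_congr rfl fun _ _ => by ring

theorem tensor_diagonal_mul_block (A : Op ι) (d : (κ → Fin 2) → ℂ)
    (G : Matrix (ι → Fin 2) m ℂ) (c : κ → Fin 2) :
    tensor A (diagonal d) * block G c = d c • block (A * G) c := by
  rw [tensor_mul_block, Finset.sum_eq_single c (fun b _ hb => by simp [hb]) (by simp),
    diagonal_apply_eq]

theorem tensor_mulVec_elim (A : Op ι) (B : Op κ) (v : (ι ⊕ κ → Fin 2) → ℂ) (x : ι → Fin 2)
    (c : κ → Fin 2) :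
    (tensor A B *ᵥ v) (Sum.elim x c) = ∑ c', B c c' * (A *ᵥ slice v c') x := by
  simp only [mulVec, dotProduct, sum_sum_elim, tensor_elim, slice, Finset.mul_sum]
  rw [Finset.sum_comm]
  exact Finset.sum_congr rfl fun _ _ => Finset.sum_congr rfl fun _ _ => by ring

theorem tensor_diagonal_diagonal (d : (ι → Fin 2) → ℂ) (e : (κ → Fin 2) → ℂ) :
    tensor (diagonal d) (diagonal e) = diagonal fun z => d (z ∘ Sum.inl) * e (z ∘ Sum.inr) := by
  ext z w
  rw [← Sum.elim_comp_inl_inr z, ← Sum.elim_comp_inl_inr w]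
  simp only [tensor_elim, diagonal_apply, elim_eq_elim_iff, Sum.elim_comp_inl, Sum.elim_comp_inr]
  split_ifs <;> simp_all

end Slices

section Forms

variable {n : Type*} [Fintype n] [DecidableEq n]

theorem star_dotProduct_self_re (v : n → ℂ) : (star v ⬝ᵥ v).re = ∑ i, ‖v i‖ ^ 2 := by
  simp [dotProduct, ← Complex.normSq_eq_norm_sq, Complex.normSq_apply]

theorem form_conjTranspose_mul_self {m : Type*} [Fintype m] [DecidableEq m]
    (D : Matrix m n ℂ) (v : n → ℂ) :
    (star v ⬝ᵥ (Dᴴ * D) *ᵥ v).re = ∑ i, ‖(D *ᵥ v) i‖ ^ 2 := by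
  rw [← mulVec_mulVec, dotProduct_mulVec, ← star_mulVec, star_dotProduct_self_re]

theorem form_diagonal (p : n → Prop) [DecidablePred p] (v : n → ℂ) :
    (star v ⬝ᵥ (diagonal fun i => if p i then (1 : ℂ) else 0) *ᵥ v).re =
      ∑ i, if p i then ‖v i‖ ^ 2 else 0 := by
  simp only [dotProduct, mulVec_diagonal, Complex.re_sum]
  refine Finset.sum_congr rfl fun i _ => ?_
  split_ifs <;> simp [← Complex.normSq_eq_norm_sq, Complex.normSq_apply]

theorem sum_norm_sq_mulVec {U : Matrix n n ℂ} (hU : Uᴴ * U = 1) (v : n → ℂ) :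
    ∑ i, ‖(U *ᵥ v) i‖ ^ 2 = ∑ i, ‖v i‖ ^ 2 := by
  rw [← form_conjTranspose_mul_self, hU, one_mulVec, star_dotProduct_self_re]

theorem posSemidef_diagonal_ite (p : n → Prop) [DecidablePred p] :
    (diagonal fun i => if p i then (1 : ℂ) else 0).PosSemidef :=
  .diagonal fun i => by
    rw [Pi.zero_apply]
    split_ifs <;> simp

end Forms

/-! ### The path Laplacian -/

section Path

/-- Telescoping along the path, then Cauchy–Schwarz. -/
theorem norm_sub_zero_sq_le (f : ℕ → ℂ) {N t : ℕ} (ht : t ≤ N) :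
    ‖f t - f 0‖ ^ 2 ≤ N * ∑ s ∈ Finset.range N, ‖f s - f (s + 1)‖ ^ 2 := by
  have h1 : ‖f t - f 0‖ ≤ ∑ s ∈ Finset.range t, ‖f s - f (s + 1)‖ := by
    rw [← Finset.sum_range_sub]
    refine (norm_sum_le _ _).trans (Finset.sum_le_sum fun s _ => ?_)
    rw [norm_sub_rev]
  calc ‖f t - f 0‖ ^ 2 ≤ (∑ s ∈ Finset.range t, ‖f s - f (s + 1)‖) ^ 2 := by gcongr
    _ ≤ (Finset.range t).card * ∑ s ∈ Finset.range t, ‖f s - f (s + 1)‖ ^ 2 :=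
      sq_sum_le_card_mul_sum_sq
    _ ≤ N * ∑ s ∈ Finset.range N, ‖f s - f (s + 1)‖ ^ 2 := by
      rw [Finset.card_range]
      gcongr

/-- The mean minimizes the sum of squared deviations; the excess is `(n + 1) (c - mean)²`. -/
theorem sum_sq_sub_le (a : ℕ → ℝ) (c : ℝ) (n : ℕ) :
    ∑ t ∈ Finset.range (n + 1), a t ^ 2 - (∑ t ∈ Finset.range (n + 1), a t) ^ 2 / (n + 1) ≤
      ∑ t ∈ Finset.range (n + 1), (a t - c) ^ 2 := by
  have h : ∑ t ∈ Finset.range (n + 1), (a t - c) ^ 2 = ∑ t ∈ Finset.range (n + 1), a t ^ 2 -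
      2 * c * ∑ t ∈ Finset.range (n + 1), a t + (n + 1) * c ^ 2 := by
    simp only [sub_sq, Finset.sum_add_distrib, Finset.sum_sub_distrib, Finset.mul_sum]
    simp [mul_assoc, mul_comm c]
  rw [h]
  set S := ∑ t ∈ Finset.range (n + 1), a t
  have hn : (0 : ℝ) < n + 1 := by positivity
  have h2 : (n + 1) * (c - S / (n + 1)) ^ 2 = (n + 1) * c ^ 2 - 2 * c * S + S ^ 2 / (n + 1) := by
    field_simp
    ring
  have h3 : 0 ≤ (n + 1) * (c - S / (n + 1)) ^ 2 := by positivity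
  linarith

theorem sum_norm_sq_sub_le (f : ℕ → ℂ) (c : ℂ) (n : ℕ) :
    ∑ t ∈ Finset.range (n + 1), ‖f t‖ ^ 2 - ‖∑ t ∈ Finset.range (n + 1), f t‖ ^ 2 / (n + 1) ≤
      ∑ t ∈ Finset.range (n + 1), ‖f t - c‖ ^ 2 := by
  have h1 := sum_sq_sub_le (fun t => (f t).re) c.re n
  have h2 := sum_sq_sub_le (fun t => (f t).im) c.im n
  simp only [← Complex.normSq_eq_norm_sq, Complex.normSq_apply, ← sq, Complex.sub_re,
    Complex.sub_im, Finset.sum_add_distrib, Complex.re_sum, Complex.im_sum, add_div]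
  linarith

/-- The lower bound on the spectral gap of the channel Hamiltonian with `N` clock qubits. -/
noncomputable def pathGap (N : ℕ) : ℝ := (2 * ((N : ℝ) + 1) ^ 2)⁻¹

theorem pathGap_pos (N : ℕ) : 0 < pathGap N := by
  rw [pathGap]; positivity

theorem pathGap_le_one (N : ℕ) : pathGap N ≤ 1 := by
  refine inv_le_one_of_one_le₀ ?_
  nlinarith [(Nat.cast_nonneg N : (0 : ℝ) ≤ N)]

/-- Poincaré's inequality on a path. -/
theorem pathGap_mul_variance_le (f : ℕ → ℂ) (N : ℕ) :
    pathGap N * (∑ t ∈ Finset.range (N + 1), ‖f t‖ ^ 2 -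
      ‖∑ t ∈ Finset.range (N + 1), f t‖ ^ 2 / (N + 1)) ≤
      ∑ s ∈ Finset.range N, ‖f s - f (s + 1)‖ ^ 2 := by
  set E := ∑ s ∈ Finset.range N, ‖f s - f (s + 1)‖ ^ 2
  have hE : 0 ≤ E := Finset.sum_nonneg fun _ _ => by positivity
  rw [pathGap, inv_mul_le_iff₀ (by positivity)]
  -- Centring at `f 0` instead of the mean only increases the sum and lets each deviation be
  -- telescoped.
  refine (sum_norm_sq_sub_le f (f 0) N).trans ?_
  refine (Finset.sum_le_card_nsmul _ _ (N * E) fun t ht =>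
    norm_sub_zero_sq_le f (Nat.lt_succ_iff.1 (Finset.mem_range.1 ht))).trans ?_
  rw [Finset.card_range, nsmul_eq_mul, ← mul_assoc]
  refine mul_le_mul_of_nonneg_right ?_ hE
  push_cast
  nlinarith [(Nat.cast_nonneg N : (0 : ℝ) ≤ N)]

/-- The path Laplacian with a penalty at the end point. -/
theorem pathGap_mul_sum_le (f : ℕ → ℂ) (N : ℕ) :
    pathGap N * ∑ t ∈ Finset.range (N + 1), ‖f t‖ ^ 2 ≤
      ∑ s ∈ Finset.range N, ‖f s - f (s + 1)‖ ^ 2 + ‖f 0‖ ^ 2 := by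
  set E := ∑ s ∈ Finset.range N, ‖f s - f (s + 1)‖ ^ 2
  have hE : 0 ≤ E := Finset.sum_nonneg fun _ _ => by positivity
  rw [pathGap, inv_mul_le_iff₀ (by positivity)]
  -- From `‖f t‖² ≤ 2 ‖f t - f 0‖² + 2 ‖f 0‖² ≤ 2 N E + 2 ‖f 0‖²`. Summing `N + 1` such bounds
  -- produces the factor `2 (N + 1)²` in `pathGap`.
  refine (Finset.sum_le_card_nsmul _ _ (2 * (N + 1) * (E + ‖f 0‖ ^ 2)) fun t ht => ?_).trans ?_
  · have h1 := norm_sub_zero_sq_le f (Nat.lt_succ_iff.1 (Finset.mem_range.1 ht))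
    have h2 : ‖f t‖ ≤ ‖f t - f 0‖ + ‖f 0‖ := by
      simpa using norm_add_le (f t - f 0) (f 0)
    have h3 : ‖f t‖ ^ 2 ≤ (‖f t - f 0‖ + ‖f 0‖) ^ 2 := by gcongr
    nlinarith [sq_nonneg (‖f t - f 0‖ - ‖f 0‖), sq_nonneg ‖f 0‖,
      mul_nonneg (Nat.cast_nonneg N : (0 : ℝ) ≤ N) (sq_nonneg ‖f 0‖)]
  · rw [Finset.card_range, nsmul_eq_mul]
    push_cast
    apply le_of_eq
    ring

end Path

/-! ### The steps of the propagation Hamiltonian -/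

section Step

variable {ι : Type} [Fintype ι] [DecidableEq ι] {N : ℕ}

/-- The defect `V ⊗ |100⟩⟨100| - I ⊗ |100⟩⟨110|` of the propagation from time `t` to `t + 1`. -/
def stepDefect (N t : ℕ) (V : Op ι) : Op (ι ⊕ Fin N) :=
  tensor V (clockPattern N t 1 0 0) - tensor 1 (clockRaise N t)ᴴ

theorem clockPattern_conjTranspose (N t : ℕ) (a b d : Fin 2) :
    (clockPattern N t a b d)ᴴ = clockPattern N t a b d :=
  (posSemidef_diagonal_ite _).1.eq

theorem clockPattern_mul_self (N t : ℕ) (a b d : Fin 2) :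
    clockPattern N t a b d * clockPattern N t a b d = clockPattern N t a b d := by
  rw [clockPattern, diagonal_mul_diagonal]
  congr 1; funext c
  split_ifs <;> simp

/-- Expanding `D† D` gives the two hopping terms plus the diagonal patterns `100` and `110`. The
clock projectors also contain `101` and `010`, which remain as positive terms supported on illegal
strings. -/
theorem step_eq {t : ℕ} (ht : t < N) {V : Op ι} (hV : Vᴴ * V = 1) :
    -tensor V (clockRaise N t) - tensor Vᴴ (clockRaise N t)ᴴ + tensor 1 (clockProj N t) +
      tensor 1 (clockProj N (t + 1)) =
    (stepDefect N t V)ᴴ * stepDefect N t V + tensor 1 (clockPattern N t 1 0 1) +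
      tensor 1 (clockPattern N t 0 1 0) := by
  have h1 := clockRaise_mul_clockPattern N t
  have h2 : clockPattern N t 1 0 0 * (clockRaise N t)ᴴ = (clockRaise N t)ᴴ := by
    rw [← clockPattern_conjTranspose, ← conjTranspose_mul, h1]
  rw [stepDefect, conjTranspose_sub, tensor_conjTranspose, tensor_conjTranspose,
    clockPattern_conjTranspose, conjTranspose_conjTranspose, conjTranspose_one,
    mul_sub, sub_mul, sub_mul, tensor_mul_tensor, tensor_mul_tensor, tensor_mul_tensor,
    tensor_mul_tensor, hV, h1, h2, clockPattern_mul_self, clockRaise_mul_conjTranspose ht,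
    clockProj_eq, clockProj_succ_eq, tensor_add_right, tensor_add_right, one_mul, one_mul, mul_one]
  abel

theorem posSemidef_tensor_diagonal (p : (ι → Fin 2) → Prop) [DecidablePred p]
    (q : (Fin N → Fin 2) → Prop) [DecidablePred q] :
    (tensor (diagonal fun x => if p x then (1 : ℂ) else 0)
      (diagonal fun c => if q c then (1 : ℂ) else 0)).PosSemidef := by
  rw [tensor_diagonal_diagonal]
  refine .diagonal fun z => ?_
  simp only [Pi.zero_apply]
  split_ifs <;> simp

theorem posSemidef_tensor_one (q : (Fin N → Fin 2) → Prop) [DecidablePred q] :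
    (tensor (1 : Op ι) (diagonal fun c => if q c then (1 : ℂ) else 0)).PosSemidef := by
  have := posSemidef_tensor_diagonal (ι := ι) (fun _ => True) q
  simpa using this

theorem form_tensor_diagonal (p : (ι → Fin 2) → Prop) [DecidablePred p]
    (q : (Fin N → Fin 2) → Prop) [DecidablePred q] (v : (ι ⊕ Fin N → Fin 2) → ℂ) :
    (star v ⬝ᵥ tensor (diagonal fun x => if p x then (1 : ℂ) else 0)
      (diagonal fun c => if q c then (1 : ℂ) else 0) *ᵥ v).re =
      ∑ x, ∑ c, if p x ∧ q c then ‖slice v c x‖ ^ 2 else 0 := by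
  have h : tensor (diagonal fun x => if p x then (1 : ℂ) else 0)
      (diagonal fun c => if q c then (1 : ℂ) else 0) =
      diagonal fun z : ι ⊕ Fin N → Fin 2 =>
        if p (z ∘ Sum.inl) ∧ q (z ∘ Sum.inr) then (1 : ℂ) else 0 := by
    rw [tensor_diagonal_diagonal]
    congr 1; funext z
    split_ifs <;> simp_all
  rw [h, form_diagonal, sum_sum_elim]
  rfl

theorem posSemidef_step {t : ℕ} (ht : t < N) {V : Op ι} (hV : Vᴴ * V = 1) :
    (-tensor V (clockRaise N t) - tensor Vᴴ (clockRaise N t)ᴴ + tensor 1 (clockProj N t) +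
      tensor 1 (clockProj N (t + 1))).PosSemidef := by
  rw [step_eq ht hV]
  exact ((posSemidef_conjTranspose_mul_self _).add (posSemidef_tensor_one _)).add
    (posSemidef_tensor_one _)

theorem stepDefect_mulVec_unary {t : ℕ} (ht : t < N) (V : Op ι) (v : (ι ⊕ Fin N → Fin 2) → ℂ)
    (x : ι → Fin 2) :
    (stepDefect N t V *ᵥ v) (Sum.elim x (unary N t)) =
      (V *ᵥ slice v (unary N t) - slice v (unary N (t + 1))) x := by
  rw [stepDefect, sub_mulVec, Pi.sub_apply, Pi.sub_apply, tensor_mulVec_elim, tensor_mulVec_elim,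
    Finset.sum_eq_single (unary N t) (fun c _ hc => ?_) (by simp),
    clockPattern_one_zero_zero_unary ht.le, one_mul,
    Finset.sum_eq_single (unary N (t + 1)) (fun c _ hc => ?_) (by simp)]
  · rw [conjTranspose_apply, clockRaise_apply_unary ht ht, if_pos ⟨rfl, rfl⟩, star_one, one_mul,
      one_mulVec]
  · rw [conjTranspose_apply, clockRaise, if_neg, star_zero, zero_mul]
    rintro ⟨h1, h2, h3, h4, h5⟩
    refine hc (funext fun i => ?_)
    by_cases hi : (i : ℕ) = t
    · have hi' : i = ⟨t, ht⟩ := Fin.ext hi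
      rw [hi', ← clockBit_succ c ht, h4]
      simp [unary]
    · rw [h5 i hi, unary, unary]
      congr 1
      simp only [eq_iff_iff]
      omega
  · rw [clockPattern, diagonal_apply_ne _ (Ne.symm hc), zero_mul]

/-- Only the rows of `D v` with clock string `1^t 0^(N-t)` are kept. Everything discarded is
nonnegative, so interaction with illegal clock strings never has to be analysed. -/
theorem form_step_ge {t : ℕ} (ht : t < N) {V : Op ι} (hV : Vᴴ * V = 1)
    (v : (ι ⊕ Fin N → Fin 2) → ℂ) :
    ∑ x, ‖(V *ᵥ slice v (unary N t) - slice v (unary N (t + 1))) x‖ ^ 2 ≤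
      (star v ⬝ᵥ (-tensor V (clockRaise N t) - tensor Vᴴ (clockRaise N t)ᴴ +
        tensor 1 (clockProj N t) + tensor 1 (clockProj N (t + 1))) *ᵥ v).re := by
  rw [step_eq ht hV, add_mulVec, add_mulVec, dotProduct_add, dotProduct_add, Complex.add_re,
    Complex.add_re, form_conjTranspose_mul_self, sum_sum_elim]
  have h1 := (posSemidef_tensor_one (ι := ι) (N := N) fun c => clockBit c t = 1 ∧
    clockBit c (t + 1) = 0 ∧ clockBit c (t + 2) = 1).re_dotProduct_nonneg v
  have h2 := (posSemidef_tensor_one (ι := ι) (N := N) fun c => clockBit c t = 0 ∧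
    clockBit c (t + 1) = 1 ∧ clockBit c (t + 2) = 0).re_dotProduct_nonneg v
  refine le_trans (Finset.sum_le_sum fun x _ => ?_) ((le_add_of_nonneg_right h1).trans
    (le_add_of_nonneg_right h2))
  rw [← stepDefect_mulVec_unary ht]
  exact Finset.single_le_sum (f := fun c => ‖(stepDefect N t V *ᵥ v) (Sum.elim x c)‖ ^ 2)
    (fun _ _ => by positivity) (Finset.mem_univ _)

variable {m : Type} [Fintype m] [DecidableEq m]

theorem stepDefect_mul_block {s t : ℕ} (ht : t < N) (hs : s ≤ N) (V : Op ι)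
    (G : Matrix (ι → Fin 2) m ℂ) :
    stepDefect N t V * block G (unary N s) =
      (if s = t then block (V * G) (unary N t) else 0) -
        if s = t + 1 then block G (unary N t) else 0 := by
  rw [stepDefect, Matrix.sub_mul, clockPattern, tensor_diagonal_mul_block, tensor_mul_block]
  congr 1
  · have : (clockBit (unary N s) t = 1 ∧ clockBit (unary N s) (t + 1) = 0 ∧
        clockBit (unary N s) (t + 2) = 0) ↔ s = t := by
      simp only [clockBit_unary hs]
      simp
      omega
    simp only [this, ite_smul, one_smul, zero_smul]
    split_ifs with h
    · rw [h]
    · rfl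
  · simp only [conjTranspose_apply, clockRaise_apply_unary ht hs, Matrix.one_mul]
    split_ifs with h
    · rw [Finset.sum_eq_single (unary N t) (fun c _ hc => by simp [hc]) (by simp)]
      simp [h]
    · simp [h]

/-- The bits of a unary string never increase, so a pattern containing an increase annihilates it.
-/
theorem tensor_one_clockPattern_mul_block {s t : ℕ} (hs : s ≤ N) (a b d : Fin 2)
    (habd : ¬ (b ≤ a ∧ d ≤ b)) (G : Matrix (ι → Fin 2) m ℂ) :
    tensor (1 : Op ι) (clockPattern N t a b d) * block G (unary N s) = 0 := by
  rw [clockPattern, tensor_diagonal_mul_block, if_neg, zero_smul]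
  rintro ⟨rfl, rfl, rfl⟩
  refine habd ⟨?_, ?_⟩
  · rw [clockBit_unary hs, clockBit_unary hs]
    split_ifs <;> omega
  · rw [clockBit_unary hs, clockBit_unary hs]
    split_ifs <;> omega

end Step

/-! ### History states -/

section History

variable {nA nB T : ℕ}

/-- The unitary `V_t ⋯ V_1`. -/
def partialCircuit {ι : Type} [Fintype ι] [DecidableEq ι] (V : Fin T → Op ι) : ℕ → Op ι
  | 0 => 1
  | t + 1 => gateAt V t * partialCircuit V t

/-- The isometry `|a⟩ ↦ |a⟩_A |0⟩_B |0⟩_E`. -/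
def inputIsometry (nA nB : ℕ) : Matrix (Work nA nB → Fin 2) (Fin nA → Fin 2) ℂ :=
  fun x a => if x = Sum.elim a 0 then 1 else 0

/-- The isometry from `A` to the history states
`(N + 1)^{-1/2} ∑ₜ V_t ⋯ V_1 |a⟩_A |0⟩_B |0⟩_E |t⟩_C`. -/
noncomputable def history (V : Fin T → Op (Work nA nB)) (N : ℕ) :
    Matrix (Work nA nB ⊕ Fin N → Fin 2) (Fin nA → Fin 2) ℂ :=
  (((√((N : ℝ) + 1))⁻¹ : ℝ) : ℂ) • ∑ t ∈ Finset.range (N + 1),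
    block (partialCircuit V t * inputIsometry nA nB) (unary N t)

theorem gateAt_unitary {ι : Type} [Fintype ι] [DecidableEq ι] {V : Fin T → Op ι}
    (hV : ∀ t, IsGate (V t)) (t : ℕ) : (gateAt V t)ᴴ * gateAt V t = 1 := by
  rw [gateAt]
  split_ifs with h
  · exact mem_unitaryGroup_iff'.1 (hV _).1
  · simp

theorem partialCircuit_unitary {ι : Type} [Fintype ι] [DecidableEq ι] {V : Fin T → Op ι}
    (hV : ∀ t, IsGate (V t)) (t : ℕ) : (partialCircuit V t)ᴴ * partialCircuit V t = 1 := by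
  induction t with
  | zero => simp [partialCircuit]
  | succ t ih =>
    rw [partialCircuit, conjTranspose_mul, Matrix.mul_assoc, ← Matrix.mul_assoc (gateAt V t)ᴴ,
      gateAt_unitary hV, Matrix.one_mul, ih]

theorem partialCircuit_eq_prod {ι : Type} [Fintype ι] [DecidableEq ι] (V : Fin T → Op ι) (t : ℕ) :
    partialCircuit V t = ((List.range t).map (gateAt V)).reverse.prod := by
  induction t with
  | zero => rfl
  | succ t ih => simp [partialCircuit, List.range_succ, ih]

theorem partialCircuit_eq_circuitUnitary {ι : Type} [Fintype ι] [DecidableEq ι]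
    (V : Fin T → Op ι) {t : ℕ} (ht : T ≤ t) : partialCircuit V t = circuitUnitary V := by
  induction t, ht using Nat.le_induction with
  | base =>
    rw [partialCircuit_eq_prod, circuitUnitary]
    congr 2
    refine List.ext_getElem (by simp) fun i h1 h2 => ?_
    have : i < T := by simpa using h2
    simp [gateAt, this]
  | succ t ht ih => rw [partialCircuit, ih, gateAt, dif_neg (by omega), Matrix.one_mul]

theorem conjTranspose_inputIsometry_mul (nA nB : ℕ) {m : Type*}
    (M : Matrix (Work nA nB → Fin 2) m ℂ) :
    (inputIsometry nA nB)ᴴ * M = M.submatrix (fun a => Sum.elim a 0) id := by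
  ext a b
  simp [inputIsometry, Matrix.mul_apply, apply_ite, ite_mul]

theorem inputIsometry_isometry (nA nB : ℕ) :
    (inputIsometry nA nB)ᴴ * inputIsometry nA nB = 1 := by
  rw [conjTranspose_inputIsometry_mul]
  ext a b
  simp [inputIsometry, Matrix.one_apply, elim_eq_elim_iff]

theorem conjTranspose_inputIsometry_mulVec (w : (Work nA nB → Fin 2) → ℂ) (a : Fin nA → Fin 2) :
    ((inputIsometry nA nB)ᴴ *ᵥ w) a = w (Sum.elim a 0) := by
  simp [inputIsometry, mulVec, dotProduct, apply_ite, ite_mul]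

theorem oneProj_mul_inputIsometry (q : Fin nB ⊕ Fin (nA + nB)) :
    oneProj (Sum.inr q : Work nA nB) * inputIsometry nA nB = 0 := by
  ext x a
  rw [oneProj, diagonal_mul, inputIsometry, Matrix.zero_apply]
  split_ifs with h1 h2 <;> simp
  rw [h2] at h1
  simp at h1

theorem zeroState_apply {ι : Type} [Fintype ι] [DecidableEq ι] (x y : ι → Fin 2) :
    zeroState ι x y = if x = 0 then (if y = 0 then 1 else 0) else 0 := by
  rw [zeroState, single_apply, ← ite_and]
  exact if_congr (and_congr eq_comm eq_comm) rfl rfl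

theorem inputIsometry_conj (σ : Op (Fin nA)) :
    inputIsometry nA nB * σ * (inputIsometry nA nB)ᴴ =
      tensor σ (tensor (zeroState (Fin nB)) (zeroState (Fin (nA + nB)))) := by
  have key : ∀ (x : Work nA nB → Fin 2) (a : Fin nA → Fin 2), inputIsometry nA nB x a =
      if a = x ∘ Sum.inl then
        (if x ∘ Sum.inr ∘ Sum.inl = 0 then (if x ∘ Sum.inr ∘ Sum.inr = 0 then 1 else 0) else 0)
      else 0 := by
    intro x a
    rw [inputIsometry, ← ite_and, ← ite_and]
    refine if_congr ⟨?_, ?_⟩ rfl rfl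
    · rintro rfl
      exact ⟨⟨rfl, rfl⟩, rfl⟩
    · rintro ⟨⟨rfl, h1⟩, h2⟩
      funext i
      rcases i with i | i | i
      · rfl
      · exact congr_fun h1 i
      · exact congr_fun h2 i
  ext x y
  simp only [Matrix.mul_apply, conjTranspose_apply, key, ite_mul, zero_mul, apply_ite star,
    star_zero, star_one, mul_ite, mul_zero, mul_one, one_mul, Finset.sum_ite_eq',
    Finset.mem_univ, if_true, tensor, zeroState_apply, Function.comp_assoc]
  split_ifs <;> rfl

variable {V : Fin T → Op (Work nA nB)}

theorem stateAt_isometry (hV : ∀ t, IsGate (V t)) (t : ℕ) :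
    (partialCircuit V t * inputIsometry nA nB)ᴴ * (partialCircuit V t * inputIsometry nA nB) =
      1 := by
  rw [conjTranspose_mul, Matrix.mul_assoc, ← Matrix.mul_assoc (partialCircuit V t)ᴴ,
    partialCircuit_unitary hV, Matrix.one_mul, inputIsometry_isometry]

theorem inv_sqrt_mul_inv_sqrt (N : ℕ) :
    (((√((N : ℝ) + 1))⁻¹ : ℝ) : ℂ) * (((√((N : ℝ) + 1))⁻¹ : ℝ) : ℂ) =
      (((N : ℝ) + 1)⁻¹ : ℝ) := by
  rw [← Complex.ofReal_mul, ← mul_inv, Real.mul_self_sqrt (by positivity)]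

theorem sum_sum_unary {α : Type*} [AddCommMonoid α] (N : ℕ) (f : ℕ → ℕ → α) :
    (∑ s ∈ Finset.range (N + 1), ∑ t ∈ Finset.range (N + 1),
      if unary N s = unary N t then f s t else 0) = ∑ t ∈ Finset.range (N + 1), f t t := by
  refine Finset.sum_congr rfl fun s hs => ?_
  have hs' := Nat.lt_succ_iff.1 (Finset.mem_range.1 hs)
  rw [Finset.sum_eq_single_of_mem s hs fun t ht hts => if_neg fun h => hts ?_, if_pos rfl]
  exact ((unary_inj hs' (Nat.lt_succ_iff.1 (Finset.mem_range.1 ht))).1 h).symm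

theorem history_isometry (hV : ∀ t, IsGate (V t)) (N : ℕ) :
    (history V N)ᴴ * history V N = 1 := by
  rw [history, conjTranspose_smul, Matrix.smul_mul, Matrix.mul_smul, smul_smul, Complex.star_def,
    Complex.conj_ofReal, inv_sqrt_mul_inv_sqrt, conjTranspose_sum, Matrix.sum_mul]
  simp only [Matrix.mul_sum, conjTranspose_block_mul_block]
  rw [sum_sum_unary N fun s t => (partialCircuit V s * inputIsometry nA nB)ᴴ *
    (partialCircuit V t * inputIsometry nA nB)]
  simp only [stateAt_isometry hV, Finset.sum_const, Finset.card_range]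
  rw [← Nat.cast_smul_eq_nsmul ℂ, smul_smul]
  have : ((N : ℂ) + 1) ≠ 0 := by exact_mod_cast N.succ_ne_zero
  push_cast
  rw [inv_mul_cancel₀ this, one_smul]

theorem traceRight_sum {ι κ α : Type} [Fintype κ] [DecidableEq κ] (s : Finset α)
    (f : α → Op (ι ⊕ κ)) : traceRight (∑ a ∈ s, f a) = ∑ a ∈ s, traceRight (f a) := by
  ext x y
  simp only [traceRight, Matrix.sum_apply]
  exact Finset.sum_comm

theorem traceRight_smul {ι κ : Type} [Fintype κ] [DecidableEq κ] (r : ℂ) (M : Op (ι ⊕ κ)) :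
    traceRight (r • M) = r • traceRight M := by
  ext x y
  simp [traceRight, Finset.mul_sum]

/-- Distinct clock strings are orthogonal, so tracing out the clock removes all coherences between
different times. -/
theorem traceRight_history (σ : Op (Fin nA)) (N : ℕ) :
    traceRight (history V N * σ * (history V N)ᴴ) =
      (((N : ℝ) + 1)⁻¹ : ℝ) • ∑ t ∈ Finset.range (N + 1),
        partialCircuit V t * inputIsometry nA nB * σ *
          (partialCircuit V t * inputIsometry nA nB)ᴴ := by
  rw [history, conjTranspose_smul, Matrix.smul_mul, Matrix.smul_mul, Matrix.mul_smul, smul_smul,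
    Complex.star_def, Complex.conj_ofReal, inv_sqrt_mul_inv_sqrt, traceRight_smul,
    conjTranspose_sum, Matrix.sum_mul, Matrix.sum_mul, traceRight_sum]
  simp only [Matrix.mul_sum, traceRight_sum, traceRight_block]
  rw [sum_sum_unary N fun s t => partialCircuit V s * inputIsometry nA nB * σ *
    (partialCircuit V t * inputIsometry nA nB)ᴴ]
  ext x y
  simp

end History

/-! ### The ground space of the channel Hamiltonian -/

section Ground

variable {nA nB T : ℕ} {V : Fin T → Op (Work nA nB)}

theorem posSemidef_hIn (nA nB N : ℕ) : (hIn nA nB N).PosSemidef :=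
  posSemidef_sum _ fun _ _ => posSemidef_tensor_diagonal _ _

theorem posSemidef_hClock (nA nB N : ℕ) : (hClock nA nB N).PosSemidef :=
  posSemidef_sum _ fun _ _ => posSemidef_tensor_one _

theorem posSemidef_hProp (hV : ∀ t, IsGate (V t)) (L : ℕ) : (hProp V L).PosSemidef :=
  posSemidef_sum _ fun t ht => posSemidef_step (Finset.mem_range.1 ht) (gateAt_unitary hV t)

theorem posSemidef_channelHamiltonian (hV : ∀ t, IsGate (V t)) (L : ℕ) :
    (channelHamiltonian V L).PosSemidef :=
  ((posSemidef_hIn _ _ _).add (posSemidef_hProp hV L)).add (posSemidef_hClock _ _ _)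

theorem hIn_mul_history (V : Fin T → Op (Work nA nB)) (N : ℕ) :
    hIn nA nB N * history V N = 0 := by
  rw [hIn, history, Matrix.mul_smul, Matrix.sum_mul, Finset.sum_eq_zero, smul_zero]
  intro q _
  rw [Matrix.mul_sum]
  refine Finset.sum_eq_zero fun t ht => ?_
  rw [clockProj, tensor_diagonal_mul_block]
  simp only [clockBit_unary (Nat.lt_succ_iff.1 (Finset.mem_range.1 ht))]
  rcases t with _ | t
  · rw [partialCircuit, Matrix.one_mul, oneProj_mul_inputIsometry]
    ext z a
    simp [block]
  · simp

theorem hClock_mul_history (V : Fin T → Op (Work nA nB)) (N : ℕ) :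
    hClock nA nB N * history V N = 0 := by
  rw [hClock, history, Matrix.mul_smul, Matrix.sum_mul, Finset.sum_eq_zero, smul_zero]
  intro i _
  rw [Matrix.mul_sum]
  refine Finset.sum_eq_zero fun t ht => ?_
  rw [clockPenalty, tensor_diagonal_mul_block, if_neg, zero_smul]
  rw [clockBit_unary (Nat.lt_succ_iff.1 (Finset.mem_range.1 ht)),
    clockBit_unary (Nat.lt_succ_iff.1 (Finset.mem_range.1 ht))]
  simp
  omega

theorem hProp_mul_history (hV : ∀ t, IsGate (V t)) (L : ℕ) :
    hProp V L * history V (T + L) = 0 := by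
  rw [hProp, Matrix.sum_mul]
  refine Finset.sum_eq_zero fun t ht => ?_
  have ht' := Finset.mem_range.1 ht
  have hpat : ∀ a b d : Fin 2, ¬ (b ≤ a ∧ d ≤ b) →
      tensor (1 : Op (Work nA nB)) (clockPattern (T + L) t a b d) * history V (T + L) = 0 := by
    intro a b d h
    rw [history, Matrix.mul_smul, Matrix.mul_sum, Finset.sum_eq_zero, smul_zero]
    exact fun s hs => tensor_one_clockPattern_mul_block
      (Nat.lt_succ_iff.1 (Finset.mem_range.1 hs)) a b d h _
  -- Only the blocks at times `t` and `t + 1` survive, and they cancel because the circuit state at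
  -- `t + 1` is `V_{t+1}` applied to the one at `t`.
  have hdef : stepDefect (T + L) t (gateAt V t) * history V (T + L) = 0 := by
    rw [history, Matrix.mul_smul, Matrix.mul_sum, Finset.sum_congr rfl fun s hs =>
      stepDefect_mul_block ht' (Nat.lt_succ_iff.1 (Finset.mem_range.1 hs)) _ _,
      Finset.sum_sub_distrib, Finset.sum_ite_eq', Finset.sum_ite_eq',
      if_pos (Finset.mem_range.2 (by omega)), if_pos (Finset.mem_range.2 (by omega)),
      partialCircuit, Matrix.mul_assoc, sub_self, smul_zero]
  rw [step_eq ht' (gateAt_unitary hV t), Matrix.add_mul, Matrix.add_mul, Matrix.mul_assoc, hdef,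
    hpat _ _ _ (by decide), hpat _ _ _ (by decide)]
  simp

theorem channelHamiltonian_mul_history (hV : ∀ t, IsGate (V t)) (L : ℕ) :
    channelHamiltonian V L * history V (T + L) = 0 := by
  rw [channelHamiltonian, Matrix.add_mul, Matrix.add_mul, hIn_mul_history, hProp_mul_history hV,
    hClock_mul_history]
  simp

/-- The vector `v` at time `t`, with the circuit up to time `t` undone. -/
def rewind {N : ℕ} (V : Fin T → Op (Work nA nB)) (v : (Work nA nB ⊕ Fin N → Fin 2) → ℂ) (t : ℕ) :
    (Work nA nB → Fin 2) → ℂ :=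
  (partialCircuit V t)ᴴ *ᵥ slice v (unary N t)

theorem partialCircuit_unitary' (hV : ∀ t, IsGate (V t)) (t : ℕ) :
    (partialCircuit V t)ᴴᴴ * (partialCircuit V t)ᴴ = 1 := by
  rw [conjTranspose_conjTranspose]
  exact mul_eq_one_comm.1 (partialCircuit_unitary hV t)

/-- A work string that is nonzero on `B ∪ E` has some qubit equal to `1`; that one penalty, on the
clock string of time `0`, already suffices. -/
theorem form_hIn_ge {N : ℕ} (V : Fin T → Op (Work nA nB))
    (v : (Work nA nB ⊕ Fin N → Fin 2) → ℂ) :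
    ∑ x : Work nA nB → Fin 2, (if x ∘ Sum.inr = 0 then 0 else ‖rewind V v 0 x‖ ^ 2) ≤
      (star v ⬝ᵥ hIn nA nB N *ᵥ v).re := by
  rw [hIn, sum_mulVec, dotProduct_sum, Complex.re_sum]
  have h : ∀ q : Fin nB ⊕ Fin (nA + nB),
      ∑ x : Work nA nB → Fin 2, (if x (Sum.inr q) = 1 then ‖rewind V v 0 x‖ ^ 2 else 0) ≤
        (star v ⬝ᵥ tensor (oneProj (Sum.inr q : Work nA nB)) (clockProj N 0) *ᵥ v).re := by
    intro q
    rw [oneProj, clockProj, form_tensor_diagonal]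
    refine Finset.sum_le_sum fun x _ => ?_
    refine le_trans (le_of_eq ?_) (Finset.single_le_sum
      (f := fun c => if x (Sum.inr q) = 1 ∧ clockBit c 0 = 1 ∧ clockBit c (0 + 1) = 0 then
        ‖slice v c x‖ ^ 2 else 0) (fun _ _ => by positivity) (Finset.mem_univ (unary N 0)))
    simp [clockBit_unary (Nat.zero_le N), rewind, partialCircuit]
  refine le_trans ?_ (Finset.sum_le_sum fun q _ => h q)
  rw [Finset.sum_comm]
  refine Finset.sum_le_sum fun x _ => ?_
  split_ifs with hx
  · exact Finset.sum_nonneg fun _ _ => by positivity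
  · obtain ⟨q, hq⟩ := Function.ne_iff.1 hx
    have hq' : x (Sum.inr q) = 1 := by
      have h01 : ∀ a : Fin 2, a ≠ 0 → a = 1 := by decide
      exact h01 _ hq
    refine le_trans (le_of_eq ?_) (Finset.single_le_sum
      (f := fun q => if x (Sum.inr q) = 1 then ‖rewind V v 0 x‖ ^ 2 else 0)
      (fun _ _ => by positivity) (Finset.mem_univ q))
    simp [hq']

/-- Every illegal clock string contains the pattern `01` at least once and so pays at least `1`. -/
theorem form_hClock_ge {N : ℕ} (v : (Work nA nB ⊕ Fin N → Fin 2) → ℂ) :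
    ∑ c ∈ (legalClock N)ᶜ, ∑ x, ‖slice v c x‖ ^ 2 ≤ (star v ⬝ᵥ hClock nA nB N *ᵥ v).re := by
  rw [hClock, sum_mulVec, dotProduct_sum, Complex.re_sum]
  have h : ∀ i ∈ Finset.Ico 1 N,
      (star v ⬝ᵥ tensor (1 : Op (Work nA nB)) (clockPenalty N i) *ᵥ v).re =
      ∑ c, ∑ x, if clockBit c i = 0 ∧ clockBit c (i + 1) = 1 then ‖slice v c x‖ ^ 2 else 0 := by
    intro i _
    have := form_tensor_diagonal (fun _ : Work nA nB → Fin 2 => True)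
      (fun c : Fin N → Fin 2 => clockBit c i = 0 ∧ clockBit c (i + 1) = 1) v
    simp only [if_true, true_and, diagonal_one] at this
    rw [clockPenalty, this, Finset.sum_comm]
  rw [Finset.sum_congr rfl h, Finset.sum_comm (s := Finset.Ico 1 N)]
  refine le_trans ?_ (Finset.sum_le_sum_of_subset_of_nonneg
    (Finset.subset_univ (legalClock N)ᶜ) fun c _ _ =>
      Finset.sum_nonneg fun _ _ => Finset.sum_nonneg fun _ _ => by positivity)
  refine Finset.sum_le_sum fun c hc => ?_
  obtain ⟨i, hi, h01⟩ : ∃ i ∈ Finset.Ico 1 N, clockBit c i = 0 ∧ clockBit c (i + 1) = 1 := by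
    by_contra! hcon
    obtain ⟨t, ht, rfl⟩ := exists_eq_unary fun i hi h => hcon i hi h.1 h.2
    exact Finset.mem_compl.1 hc (Finset.mem_image_of_mem _ (Finset.mem_range.2 (by omega)))
  refine le_trans (le_of_eq ?_) (Finset.single_le_sum
    (f := fun i => ∑ x, if clockBit c i = 0 ∧ clockBit c (i + 1) = 1 then
      ‖slice v c x‖ ^ 2 else 0)
    (fun _ _ => Finset.sum_nonneg fun _ _ => by positivity) hi)
  simp only [if_pos h01]

/-- Applying the unitary `(V_{t+1} ⋯ V_1)†` preserves the norm and turns the defect `V_{t+1} v_t -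
v_{t+1}` into a plain difference of rewound slices. -/
theorem form_hProp_ge (hV : ∀ t, IsGate (V t)) (L : ℕ)
    (v : (Work nA nB ⊕ Fin (T + L) → Fin 2) → ℂ) :
    ∑ x, ∑ t ∈ Finset.range (T + L), ‖rewind V v t x - rewind V v (t + 1) x‖ ^ 2 ≤
      (star v ⬝ᵥ hProp V L *ᵥ v).re := by
  rw [hProp, sum_mulVec, dotProduct_sum, Complex.re_sum, Finset.sum_comm]
  refine Finset.sum_le_sum fun t ht => le_trans (le_of_eq ?_)
    (form_step_ge (Finset.mem_range.1 ht) (gateAt_unitary hV t) v)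
  rw [← sum_norm_sq_mulVec (partialCircuit_unitary' hV (t + 1))
    (gateAt V t *ᵥ slice v (unary (T + L) t) - slice v (unary (T + L) (t + 1))), mulVec_sub,
    mulVec_mulVec,
    partialCircuit, conjTranspose_mul, Matrix.mul_assoc, gateAt_unitary hV, Matrix.mul_one,
    ← conjTranspose_mul]
  rfl

theorem norm_sq_eq_sum_rewind (hV : ∀ t, IsGate (V t)) {N : ℕ}
    (v : (Work nA nB ⊕ Fin N → Fin 2) → ℂ) :
    (star v ⬝ᵥ v).re = ∑ x, ∑ t ∈ Finset.range (N + 1), ‖rewind V v t x‖ ^ 2 +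
      ∑ c ∈ (legalClock N)ᶜ, ∑ x, ‖slice v c x‖ ^ 2 := by
  rw [star_dotProduct_self_re, sum_sum_elim, Finset.sum_comm, sum_clock]
  conv_rhs => rw [Finset.sum_comm]
  congr 1
  exact Finset.sum_congr rfl fun t _ =>
    (sum_norm_sq_mulVec (partialCircuit_unitary' hV t) (slice v (unary N t))).symm

theorem norm_sq_history_mulVec {N : ℕ} (V : Fin T → Op (Work nA nB))
    (v : (Work nA nB ⊕ Fin N → Fin 2) → ℂ) :
    (star ((history V N)ᴴ *ᵥ v) ⬝ᵥ ((history V N)ᴴ *ᵥ v)).re =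
      ∑ x : Work nA nB → Fin 2, if x ∘ Sum.inr = 0 then
        ‖∑ t ∈ Finset.range (N + 1), rewind V v t x‖ ^ 2 / (N + 1) else 0 := by
  have h : ∀ a, ((history V N)ᴴ *ᵥ v) a = (((√((N : ℝ) + 1))⁻¹ : ℝ) : ℂ) *
      ∑ t ∈ Finset.range (N + 1), rewind V v t (Sum.elim a 0) := by
    intro a
    rw [history, conjTranspose_smul, Complex.star_def, Complex.conj_ofReal, smul_mulVec,
      conjTranspose_sum, sum_mulVec, Pi.smul_apply, Finset.sum_apply, smul_eq_mul]
    congr 1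
    refine Finset.sum_congr rfl fun t _ => ?_
    rw [conjTranspose_block_mulVec, conjTranspose_mul, ← mulVec_mulVec,
      conjTranspose_inputIsometry_mulVec]
    rfl
  rw [star_dotProduct_self_re, sum_sum_elim]
  refine Finset.sum_congr rfl fun a _ => ?_
  rw [Finset.sum_eq_single 0 (fun b _ hb => by simp [hb]) (by simp), h, if_pos (by simp), norm_mul,
    mul_pow, Complex.norm_real, norm_inv, inv_pow, Real.norm_of_nonneg (Real.sqrt_nonneg _),
    Real.sq_sqrt (by positivity), inv_mul_eq_div]

/-- The ground space of the channel Hamiltonian consists of the history states. -/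
theorem groundSpace_channelHamiltonian (hV : ∀ t, IsGate (V t)) (L : ℕ) :
    GroundSpace (channelHamiltonian V L) (history V (T + L)) (pathGap (T + L)) where
  posSemidef := posSemidef_channelHamiltonian hV L
  isometry := history_isometry hV _
  mul_eq_zero := channelHamiltonian_mul_history hV L
  gap_pos := pathGap_pos _
  gap_le v := by
    have h1 := form_hIn_ge V v
    have h2 := form_hProp_ge hV L v
    have h3 := form_hClock_ge v
    -- One scalar path problem per basis string `x` of the rewound work register: Poincaré when `x`
    -- vanishes on `B ∪ E`, since the time average is then the ground component, and the end-point
    -- penalty otherwise.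
    have hx : ∀ x : Work nA nB → Fin 2, pathGap (T + L) *
        (∑ t ∈ Finset.range (T + L + 1), ‖rewind V v t x‖ ^ 2 - if x ∘ Sum.inr = 0 then
          ‖∑ t ∈ Finset.range (T + L + 1), rewind V v t x‖ ^ 2 / ((T + L : ℕ) + 1) else 0) ≤
        ∑ t ∈ Finset.range (T + L), ‖rewind V v t x - rewind V v (t + 1) x‖ ^ 2 +
          (if x ∘ Sum.inr = 0 then 0 else ‖rewind V v 0 x‖ ^ 2) := by
      intro x
      split_ifs with h
      · rw [add_zero]
        exact pathGap_mul_variance_le (fun t => rewind V v t x) (T + L)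
      · rw [sub_zero]
        exact pathGap_mul_sum_le (fun t => rewind V v t x) (T + L)
    have h4 := Finset.sum_le_sum fun x (_ : x ∈ Finset.univ) => hx x
    rw [← Finset.mul_sum, Finset.sum_sub_distrib, Finset.sum_add_distrib] at h4
    have h5 : pathGap (T + L) * ∑ c ∈ (legalClock (T + L))ᶜ, ∑ x, ‖slice v c x‖ ^ 2 ≤
        ∑ c ∈ (legalClock (T + L))ᶜ, ∑ x, ‖slice v c x‖ ^ 2 :=
      mul_le_of_le_one_left (Finset.sum_nonneg fun _ _ => Finset.sum_nonneg fun _ _ => by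
        positivity) (pathGap_le_one _)
    rw [channelHamiltonian, add_mulVec, add_mulVec, dotProduct_add, dotProduct_add,
      Complex.add_re, Complex.add_re, norm_sq_eq_sum_rewind hV, norm_sq_history_mulVec,
      add_sub_right_comm, mul_add]
    linarith

/-- The ground space has dimension `2 ^ nA`. At least one further qubit makes it proper, so a
positive eigenvalue exists. -/
theorem pathGap_le_spectralGap (hV : ∀ t, IsGate (V t)) (L : ℕ) (h : 0 < nA + nB + T + L) :
    pathGap (T + L) ≤ spectralGap (channelHamiltonian V L) := by
  refine (groundSpace_channelHamiltonian hV L).le_spectralGap ?_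
  simp only [Fintype.card_pi, Fintype.card_fin, Finset.prod_const, Finset.card_univ,
    Fintype.card_sum]
  exact Nat.pow_lt_pow_right (by norm_num) (by omega)

end Ground

/-! ### The output of history states -/

section Output

variable {nA nB T : ℕ} {V : Fin T → Op (Work nA nB)}

/-- The state of `B` after `t` steps of the circuit. -/
def outputAt (V : Fin T → Op (Work nA nB)) (σ : Op (Fin nA)) (t : ℕ) : Op (Fin nB) :=
  reduceB (partialCircuit V t * inputIsometry nA nB * σ *
    (partialCircuit V t * inputIsometry nA nB)ᴴ)

theorem IsState.reduceB {ρ : Op (Work nA nB)} (h : IsState ρ) : IsState (reduceB ρ) :=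
  h.traceLeft.traceRight

theorem IsState.outputAt (hV : ∀ t, IsGate (V t)) {σ : Op (Fin nA)} (h : IsState σ) (t : ℕ) :
    IsState (outputAt V σ t) :=
  (h.conj (stateAt_isometry hV t)).reduceB

theorem outputAt_eq {Φ : Op (Fin nA) →ₗ[ℂ] Op (Fin nB)} (hΦ : ImplementsStinespring V Φ)
    (σ : Op (Fin nA)) {t : ℕ} (ht : T ≤ t) : outputAt V σ t = Φ σ := by
  rw [hΦ, outputAt, ← inputIsometry_conj, partialCircuit_eq_circuitUnitary V ht,
    conjTranspose_mul]
  simp only [Matrix.mul_assoc]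

theorem trace_mul_reduceB (Q : Op (Fin nB)) (M : Op (Work nA nB)) :
    (Q * reduceB M).trace = (tensor 1 (tensor Q 1) * M).trace := by
  rw [trace_tensor_one_left_mul, trace_tensor_one_right_mul, reduceB]

theorem trace_mul_marginalB {N : ℕ} (Q : Op (Fin nB)) (M : Op (Work nA nB ⊕ Fin N)) :
    (Q * marginalB M).trace = (tensor (tensor 1 (tensor Q 1)) 1 * M).trace := by
  rw [trace_tensor_one_right_mul, marginalB, trace_mul_reduceB]

theorem trace_mul_marginalB_history (Q : Op (Fin nB)) (σ : Op (Fin nA)) (N : ℕ) :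
    (Q * marginalB (history V N * σ * (history V N)ᴴ)).trace.re =
      ((N : ℝ) + 1)⁻¹ * ∑ t ∈ Finset.range (N + 1), (Q * outputAt V σ t).trace.re := by
  rw [marginalB, traceRight_history, trace_mul_reduceB, Matrix.mul_smul, trace_smul,
    Complex.smul_re, smul_eq_mul, Matrix.mul_sum, trace_sum, Complex.re_sum]
  simp only [outputAt, trace_mul_reduceB]

/-- In the time average of `Tr (Q ·)`, the `L + 1` times from `T` to `T + L` give exactly `Tr (Q
Φ(σ))`. Each of the other `T` times exceeds it by at most `2`, as expectations of `Q` lie in `[-1,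
1]`. -/
theorem trace_mul_history_sub_le (hV : ∀ t, IsGate (V t)) {Φ : Op (Fin nA) →ₗ[ℂ] Op (Fin nB)}
    (hΦ : ImplementsStinespring V Φ) {σ : Op (Fin nA)} (hσ : IsState σ) (L : ℕ)
    {Q : Op (Fin nB)} (hQ : Q.IsHermitian) (hQQ : Q * Q = 1) :
    (Q * marginalB (history V (T + L) * σ * (history V (T + L))ᴴ)).trace.re -
      (Q * Φ σ).trace.re ≤ 2 * (T : ℝ) / ((T : ℝ) + L + 1) := by
  have hN : (0 : ℝ) < (T : ℝ) + L + 1 := by positivity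
  rw [trace_mul_marginalB_history, Nat.cast_add, inv_mul_eq_div, sub_le_iff_le_add,
    div_le_iff₀ hN, add_mul, div_mul_cancel₀ _ hN.ne']
  have hT : Finset.range (T + L + 1) = Finset.range (T + (L + 1)) := rfl
  have hb := (hσ.outputAt hV T).neg_one_le_trace_mul hQ hQQ
  rw [outputAt_eq hΦ σ le_rfl] at hb
  have h1 : ∑ t ∈ Finset.range T, (Q * outputAt V σ t).trace.re ≤ T := by
    simpa using Finset.sum_le_sum fun t (_ : t ∈ Finset.range T) =>
      (hσ.outputAt hV t).trace_mul_le_one hQ hQQ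
  have h2 : ∑ i ∈ Finset.range (L + 1), (Q * outputAt V σ (T + i)).trace.re =
      (L + 1) * (Q * Φ σ).trace.re := by
    simp [outputAt_eq hΦ σ (Nat.le_add_right _ _)]
  rw [hT, Finset.sum_range_add, h2]
  nlinarith [mul_le_mul_of_nonneg_left hb (Nat.cast_nonneg T : (0 : ℝ) ≤ T)]

theorem isHermitian_lift {N : ℕ} {Q : Op (Fin nB)} (hQ : Q.IsHermitian) :
    (tensor (tensor 1 (tensor Q 1)) 1 : Op (Work nA nB ⊕ Fin N)).IsHermitian :=
  IsHermitian.tensor (IsHermitian.tensor isHermitian_one (IsHermitian.tensor hQ isHermitian_one))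
    isHermitian_one

theorem lift_mul_self {N : ℕ} {Q : Op (Fin nB)} (hQQ : Q * Q = 1) :
    (tensor (tensor 1 (tensor Q 1)) 1 * tensor (tensor 1 (tensor Q 1)) 1 :
      Op (Work nA nB ⊕ Fin N)) = 1 := by
  simp only [tensor_mul_tensor, hQQ, Matrix.one_mul, tensor_one_one]

theorem IsState.marginalB {N : ℕ} {ρ : Op (Work nA nB ⊕ Fin N)} (h : IsState ρ) :
    IsState (marginalB ρ) :=
  h.traceRight.reduceB

end Output

end QHam

open QHam
theorem mainTheorem8 :
    -- the constant hidden in `Ω` is universal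
    ∃ c : ℝ, 0 < c ∧
      ∀ (nA nB T L : ℕ) (Φ : Op (Fin nA) →ₗ[ℂ] Op (Fin nB)) (V : Fin T → Op (Work nA nB)),
        -- the Hamiltonian acts on at least one qubit
        0 < nA + nB + T + L →
        IsChannel Φ →
        (∀ t, IsGate (V t)) →
        ImplementsStinespring V Φ →
          IsLocalHamiltonian 5 (channelHamiltonian V L) ∧
          (∀ σ : Op (Fin nA), IsState σ →
            ∃ ρ : Op (Work nA nB ⊕ Fin (T + L)), IsState ρ ∧ (IsPure σ → IsPure ρ) ∧
              energy (channelHamiltonian V L) ρ = 0 ∧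
              traceNorm (marginalB ρ - Φ σ) ≤ 2 * (T : ℝ) / ((T : ℝ) + L + 1)) ∧
          (∀ (β : ℝ) (ρ : Op (Work nA nB ⊕ Fin (T + L))), IsState ρ →
            energy (channelHamiltonian V L) ρ ≤ β →
            ∃ σ : Op (Fin nA), IsState σ ∧ (IsPure ρ → IsPure σ) ∧
              traceNorm (marginalB ρ - Φ σ) ≤
                2 * √(β / spectralGap (channelHamiltonian V L)) +
                  2 * (T : ℝ) / ((T : ℝ) + L + 1)) ∧
          c / ((T : ℝ) + L + 1) ^ 3 ≤ spectralGap (channelHamiltonian V L) := by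
  -- The constant `1 / 2` is the one in `pathGap`.
  refine ⟨1 / 2, by norm_num, fun nA nB T L Φ V hpos _ hV hΦ => ?_⟩
  have hgap := pathGap_le_spectralGap hV L hpos
  have hground := groundSpace_channelHamiltonian hV L
  have hΦσ : ∀ {σ : Op (Fin nA)}, IsState σ → (Φ σ).IsHermitian := fun {σ} hσ => by
    rw [← outputAt_eq hΦ σ le_rfl]
    exact (hσ.outputAt hV T).1.1
  refine ⟨isLocalHamiltonian_channelHamiltonian hV L, fun σ hσ => ?_, fun β ρ hρ hβ => ?_, ?_⟩
  · have hρ := hσ.conj hground.isometry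
    refine ⟨_, hρ, fun h => h.conj hground.isometry, ?_, ?_⟩
    · rw [energy, ← Matrix.mul_assoc, ← Matrix.mul_assoc, hground.mul_eq_zero]
      simp
    · obtain ⟨Q, hQ, hQQ, hnorm⟩ := exists_traceNorm_eq (hρ.marginalB.1.1.sub (hΦσ hσ))
      rw [hnorm, mul_sub, Matrix.trace_sub, Complex.sub_re]
      exact trace_mul_history_sub_le hV hΦ hσ L hQ hQQ
  · obtain ⟨σ, hσ, hpure, hclose⟩ :=
      hground.exists_ground_state ((pathGap_pos _).trans_le hgap) hρ hβ
    refine ⟨σ, hσ, hpure, ?_⟩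
    obtain ⟨Q, hQ, hQQ, hnorm⟩ := exists_traceNorm_eq (hρ.marginalB.1.1.sub (hΦσ hσ))
    -- The optimal `Q` for the total error on `B`, padded with identities, is again a Hermitian
    -- unitary, so it can test the distance between `ρ` and `K σ K†` on all registers.
    have h1 := hclose _ (isHermitian_lift hQ) (lift_mul_self hQQ)
    have h2 := trace_mul_history_sub_le hV hΦ hσ L hQ hQQ
    rw [mul_sub, Matrix.trace_sub, Complex.sub_re, ← trace_mul_marginalB,
      ← trace_mul_marginalB] at h1
    rw [hnorm, mul_sub, Matrix.trace_sub, Complex.sub_re]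
    linarith
  · refine le_trans ?_ hgap
    have h1 : (1 : ℝ) ≤ (T : ℝ) + L + 1 := by
      have : (0 : ℝ) ≤ (T : ℝ) + L := by positivity
      linarith
    -- The quadratic bound implies the cubic one because `T + L + 1 ≥ 1`.
    rw [pathGap, Nat.cast_add, mul_inv, div_eq_mul_inv, one_div]
    gcongr
    · norm_num
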